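/- For a finite group $X$ let $\sigma(X)$ be the least number of proper subgroups of $X$ whose union is $X$ (for $X$ non-cyclic such subgroups exist). For a positive integer $m$ let $\alpha(m)$ be the number of distinct prime divisors of $m$, and let $C_m$ be the cyclic group of order $m$. Let $S$ be a nonabelian finite simple group, and let $S\wr C_m$ be the wreath product of $S$ with $C_m$, where $C_m$ permutes the $m$ coordinates of $S^m$ regularly. **Theorem 1.** Let $m$ be a positive integer. (Lower bound) Let $\Sigma$ be a nonempty subset of $S$ and let $\mathcal{M}$ be a nonempty set of maximal subgroups of $S$ such that (0) if $M\in\mathcal{M}$ then $M^s\in\mathcal{M}$ for every $s\in S$; (1) $\Sigma\cap M\neq\emptyset$ for every $M\in\mathcal{M}$; (2) $\Sigma\subseteq\bigcup_{M\in\mathcal{M}}M$; (3) $\Sigma\cap M_1\cap M_2=\emptyset$ for every pair of distinct $M_1,M_2\in\mathcal{M}$; (4) $\mathcal{M}$ contains at least two subgroups that are not conjugate in $S$; (5) $m\ge 2$ and $$\max\Big\{(1+\alpha(m))|S|^{m/\ell},\ \max_{H<S,\ H\notin\mathcal{M}}|\Sigma\cap H|\,|H|^{m-1}\Big\}\le\min\Big\{\Big(\sum|\Sigma\cap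 M_1|\,|\Sigma\cap M_2|\Big)|S|^{m-2},\ \min_{M\in\mathcal{M}}|\Sigma\cap M|\,|M|^{m-1}\Big\},$$ where $\ell$ is the smallest prime divisor of $m$, $H$ runs over the proper subgroups of $S$ that are not in $\mathcal{M}$, and the sum is over all ordered pairs $(M_1,M_2)\in\mathcal{M}^2$ with $M_1$ not conjugate to $M_2$ in $S$. Then $$\alpha(m)+\sum_{M\in\mathcal{M}}|S:M|^{m-1}\le\sigma(S\wr C_m).$$ (Upper bound) With no assumption on $m$ other than $m\ge1$, every set $\mathcal{N}$ of proper subgroups of $S$ whose union is $S$ satisfies $$\sigma(S\wr C_m)\le\alpha(m)+\sum_{M\in\mathcal{N}}|S:M|^{m-1}.$$ -/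

import Mathlib

open scoped Pointwise

/-- A covering of a group `X`: a set of proper subgroups of `X` whose union is `X`. -/
def IsCovering {X : Type*} [Group X] (𝓒 : Set (Subgroup X)) : Prop :=
  (∀ H ∈ 𝓒, H ≠ ⊤) ∧ (⋃ H ∈ 𝓒, (H : Set X)) = Set.univ

/-- The covering number `σ(X)`: the least number of proper subgroups of `X` whose union is `X`
(with value `⊤` for a group that is not a union of proper subgroups, i.e. a cyclic group). -/
noncomputable def coveringNumber (X : Type*) [Group X] : ℕ∞ :=
  ⨅ (𝓒 : Set (Subgroup X)) (_ : IsCovering 𝓒), 𝓒.encard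

/-- `α(m)`: the number of distinct prime divisors of `m`. -/
def numPrimeDivisors (m : ℕ) : ℕ := m.primeFactors.card

/-- The wreath product `S ≀ C_m` of `S` with the cyclic group of order `m` (acting regularly on
the `m` coordinates). -/
abbrev CyclicWreath (S : Type*) [Group S] (m : ℕ) : Type _ := S ≀ᵣ Multiplicative (ZMod m)

/-- Two subgroups are conjugate in `S`. -/
def SubgroupsConj {S : Type*} [Group S] (M₁ M₂ : Subgroup S) : Prop :=
  ∃ s : S, MulAut.conj s • M₁ = M₂

open Classical in
/-- The sum of `|A ∩ M₁| |A ∩ M₂|` over all ordered pairs `(M₁, M₂)` of non-conjugate members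
of `𝓜`. -/
noncomputable def nonconjPairSum {S : Type*} [Group S] (A : Set S) (𝓜 : Finset (Subgroup S)) : ℕ :=
  ∑ p ∈ (𝓜 ×ˢ 𝓜).filter (fun p => ¬ SubgroupsConj p.1 p.2),
    (A ∩ (p.1 : Set S)).ncard * (A ∩ (p.2 : Set S)).ncard

/-- The conditions on a subset `A` of `S` (the set `Σ` of the theorem) and a set `𝓜` of maximal
subgroups of `S`, relative to the exponent `m`. -/
structure AdmissiblePair {S : Type*} [Group S] (m : ℕ) (A : Set S) (𝓜 : Finset (Subgroup S)) :
    Prop where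
  nonempty_set : A.Nonempty
  nonempty_family : 𝓜.Nonempty
  maximal : ∀ M ∈ 𝓜, IsCoatom M
  conj_mem : ∀ M ∈ 𝓜, ∀ s : S, MulAut.conj s • M ∈ 𝓜
  meets : ∀ M ∈ 𝓜, (A ∩ (M : Set S)).Nonempty
  subset_iUnion : A ⊆ ⋃ M ∈ 𝓜, (M : Set S)
  disjoint : ∀ M₁ ∈ 𝓜, ∀ M₂ ∈ 𝓜, M₁ ≠ M₂ → A ∩ (M₁ : Set S) ∩ (M₂ : Set S) = ∅
  exists_nonconj : ∃ M₁ ∈ 𝓜, ∃ M₂ ∈ 𝓜, ¬ SubgroupsConj M₁ M₂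
  two_le : 2 ≤ m
  /- The next four fields say together that the maximum of `(1 + α(m)) |S| ^ (m / ℓ)`
  (with `ℓ` the least prime divisor of `m`) and of all `|A ∩ H| |H| ^ (m - 1)`, for `H` a proper
  subgroup of `S` outside `𝓜`, is at most the minimum of `nonconjPairSum A 𝓜 * |S| ^ (m - 2)`
  and of all `|A ∩ M| |M| ^ (m - 1)` for `M` in `𝓜`. -/
  diag_le_pairs : (1 + numPrimeDivisors m) * Nat.card S ^ (m / m.minFac) ≤
    nonconjPairSum A 𝓜 * Nat.card S ^ (m - 2)
  diag_le_mem : ∀ M ∈ 𝓜, (1 + numPrimeDivisors m) * Nat.card S ^ (m / m.minFac) ≤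
    (A ∩ (M : Set S)).ncard * Nat.card M ^ (m - 1)
  notMem_le_pairs : ∀ H : Subgroup S, H ≠ ⊤ → H ∉ 𝓜 →
    (A ∩ (H : Set S)).ncard * Nat.card H ^ (m - 1) ≤ nonconjPairSum A 𝓜 * Nat.card S ^ (m - 2)
  notMem_le_mem : ∀ H : Subgroup S, H ≠ ⊤ → H ∉ 𝓜 → ∀ M ∈ 𝓜,
    (A ∩ (H : Set S)).ncard * Nat.card H ^ (m - 1) ≤
      (A ∩ (M : Set S)).ncard * Nat.card M ^ (m - 1)

/-! Upper bound. If the image of z generates C_m and the first coordinate of z^m lies in M, then z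
fixes a point of (S/M)^m lying over the trivial coset at 1 (`exists_mem_funStab`). The |S:M|^(m-1)
stabilizers of such points, for M in 𝓝, contain all these z. Every other element lies in one of the
α(m) subgroups of prime index over the base group.

Lower bound. Members of a cover may be enlarged to maximal subgroups. A maximal K either contains
the base group, and is then some `overBase S m p`; or fixes a point of the product action on cosets
of a proper R; or is of diagonal type and meets the base group in at most |S|^(m/ℓ) elements
(`le_funStab_or_card_basePart_le`). Let T be the sum of |S:M|^(m-1) over 𝓜, b the number of primes p
whose `overBase` is missing from the cover, and d the number of diagonal members. It suffices that
the product-type members number at least T + b - d.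

Choose a divisor q > b of m divisible by none of the primes whose `overBase` is present. The coset
of the base group over the q-th power of the generator is then covered by product-type and diagonal
members alone. On it the q cycle products are independent and uniform, both globally and inside a
point stabilizer, where they range over a box of conjugates of R (`sum_cycleProd_mul`). Weighting
the first cycle product by 1/(|Σ ∩ M| |M|^(m-1)) on Σ ∩ M gives the coset weight T and each
product-type member weight at most 1 (`exists_weight`), hence T up to a diagonal error. The extra b
- d comes from the other q - 1 ≥ b cycle products: proper subgroups all contain the identity, so
boxes of them overlap there and cover inefficiently (`add_le_card_add_of_box_cover`). The bound on
|S|^(m/ℓ) in (5) controls the error. -/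

namespace RegularWreathProduct

/-! ### Point stabilizers in the product action. -/

variable {D Q : Type*} [Group D] [Group Q]

/-- The stabilizer of a function `f : Q → Λ` under the product action of `D ≀ᵣ Q` on `Q → Λ`. -/
def funStab {Λ : Type*} [MulAction D Λ] (f : Q → Λ) : Subgroup (D ≀ᵣ Q) where
  carrier := {z | ∀ c, z.left c • f (z.right⁻¹ * c) = f c}
  one_mem' := by simp
  mul_mem' := by
    intro a b ha hb c
    have h1 := ha c
    have h2 := hb (a.right⁻¹ * c)
    simp only [mul_left, Pi.mul_apply, mul_right, mul_inv_rev, mul_smul, mul_assoc]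
    rw [h2, h1]
  inv_mem' := by
    intro a ha c
    have h1 := ha (a.right * c)
    simp only [inv_left, Pi.inv_apply, inv_right, inv_inv]
    rw [inv_smul_eq_iff, ← h1]
    simp

theorem mem_funStab {Λ : Type*} [MulAction D Λ] {f : Q → Λ} {z : D ≀ᵣ Q} :
    z ∈ funStab f ↔ ∀ c, z.left c • f (z.right⁻¹ * c) = f c := Iff.rfl

theorem funStab_ne_top {R : Subgroup D} (hR : R ≠ ⊤) (f : Q → D ⧸ R) :
    (funStab f : Subgroup (D ≀ᵣ Q)) ≠ ⊤ := by
  intro h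
  apply hR
  rw [Subgroup.eq_top_iff']
  intro r
  obtain ⟨g, hg⟩ := QuotientGroup.mk_surjective (f 1)
  -- Conjugating r by g makes fixing the coset g R equivalent to r ∈ R.
  have h1 : (⟨fun _ => g * r * g⁻¹, 1⟩ : D ≀ᵣ Q) ∈ (funStab f : Subgroup (D ≀ᵣ Q)) := by
    rw [h]; trivial
  have h2 := h1 1
  simp only [inv_one, mul_one, ← hg] at h2
  rw [MulAction.Quotient.smul_mk, QuotientGroup.eq] at h2
  have h3 := R.inv_mem h2
  simpa [mul_assoc] using h3

theorem pow_right (z : D ≀ᵣ Q) (k : ℕ) : (z ^ k).right = z.right ^ k :=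
  map_pow (rightHom : D ≀ᵣ Q →* Q) z k

theorem pow_succ_left (z : D ≀ᵣ Q) (k : ℕ) (c : Q) :
    (z ^ (k + 1)).left c = z.left c * (z ^ k).left (z.right⁻¹ * c) := by
  rw [pow_succ']; rfl

theorem pow_succ_left' (z : D ≀ᵣ Q) (k : ℕ) (c : Q) :
    (z ^ (k + 1)).left c = (z ^ k).left c * z.left ((z.right ^ k)⁻¹ * c) := by
  rw [pow_succ, ← pow_right]; rfl

/-- An element whose right component generates `Q` fixes a point of `Q → D ⧸ M` lying over the
trivial coset as soon as the first coordinate of its `|Q|`-th power lies in `M`. -/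
theorem exists_mem_funStab [Finite Q] {M : Subgroup D} (z : D ≀ᵣ Q)
    (hz : Subgroup.zpowers z.right = ⊤) (hM : (z ^ Nat.card Q).left 1 ∈ M) :
    ∃ f : Q → D ⧸ M, f 1 = ((1 : D) : D ⧸ M) ∧ z ∈ funStab f := by
  classical
  have hgen : ∀ c : Q, ∃ k : ℕ, k < Nat.card Q ∧ z.right ^ k = c := by
    intro c
    have hc : c ∈ Subgroup.zpowers z.right := by rw [hz]; trivial
    rw [mem_zpowers_iff_mem_range_orderOf] at hc
    simp only [Finset.mem_image, Finset.mem_range] at hc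
    obtain ⟨k, hk, rfl⟩ := hc
    exact ⟨k, hk.trans_le (orderOf_le_card), rfl⟩
  have hord : orderOf z.right = Nat.card Q := by
    rw [← Nat.card_zpowers, hz, Subgroup.card_top]
  -- The coset attached to the k-th power depends only on that power of `z.right`. The case k = |Q|
  -- is included because following an orbit by one more step may wrap around; there `hM` is needed.
  have hwd : ∀ k : ℕ, ∀ l : ℕ, l < Nat.card Q → z.right ^ k = z.right ^ l → k ≤ Nat.card Q →
      (((z ^ k).left (z.right ^ k) : D) : D ⧸ M) = (((z ^ l).left (z.right ^ l) : D) : D ⧸ M) := by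
    intro k l hl hkl hk
    rcases hk.lt_or_eq with hk | hk
    · have : k = l := by
        apply pow_injOn_Iio_orderOf (x := z.right) _ _ hkl <;> simpa [hord]
      rw [this]
    · have h0 : l = 0 := by
        have : z.right ^ l = 1 := by rw [← hkl, hk]; exact pow_card_eq_one'
        by_contra h
        exact absurd (Nat.le_of_dvd (Nat.pos_of_ne_zero h) (orderOf_dvd_of_pow_eq_one this))
          (by omega)
      subst h0
      rw [QuotientGroup.eq]
      have : z.right ^ k = 1 := by rw [hkl]; simp
      rw [this, hk]
      simpa using hM
  choose e he he' using hgen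
  refine ⟨fun c => (((z ^ e c).left c : D) : D ⧸ M), ?_, ?_⟩
  · have := hwd 0 (e 1) (he 1) (by rw [he']; simp) (Nat.zero_le _)
    rw [he'] at this
    simpa using this.symm
  · intro c
    set c' := z.right⁻¹ * c with hc'
    change (((z.left c * (z ^ e c').left c' : D)) : D ⧸ M) = _
    rw [hc', ← pow_succ_left]
    have h1 : z.right ^ (e c' + 1) = c := by rw [pow_succ', he', hc']; simp
    have := hwd (e c' + 1) (e c) (he c) (by rw [h1, he']) (he c')
    rwa [h1, he'] at this

end RegularWreathProduct

/-! ### The cyclic quotient and the upper bound. -/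

/-- The distinguished generator of the cyclic group of order `m`. -/
abbrev cyclicGen (m : ℕ) : Multiplicative (ZMod m) := Multiplicative.ofAdd 1

theorem cyclicGen_pow (m k : ℕ) : cyclicGen m ^ k = Multiplicative.ofAdd (k : ZMod m) := by
  rw [← ofAdd_nsmul]; simp

theorem exists_cyclicGen_pow (m : ℕ) [NeZero m] (c : Multiplicative (ZMod m)) :
    ∃ k : ℕ, k < m ∧ cyclicGen m ^ k = c := by
  refine ⟨(Multiplicative.toAdd c).val, ZMod.val_lt _, ?_⟩
  rw [cyclicGen_pow]
  simp

theorem cyclicGen_pow_eq_iff (m k l : ℕ) :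
    cyclicGen m ^ k = cyclicGen m ^ l ↔ k ≡ l [MOD m] := by
  rw [cyclicGen_pow, cyclicGen_pow, Multiplicative.ofAdd.apply_eq_iff_eq,
    ZMod.natCast_eq_natCast_iff]

theorem card_multiplicative_zmod (m : ℕ) : Nat.card (Multiplicative (ZMod m)) = m := by
  rw [Nat.card_congr Multiplicative.toAdd, Nat.card_zmod]

theorem cyclicGen_pow_mem_zpowers_iff {m p : ℕ} (hp : p ∣ m) (q : ℕ) :
    cyclicGen m ^ q ∈ Subgroup.zpowers (cyclicGen m ^ p) ↔ p ∣ q := by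
  constructor
  · rintro ⟨k, hk⟩
    simp only [cyclicGen_pow, ← ofAdd_zsmul] at hk
    have h1 := congrArg (ZMod.castHom hp (ZMod p)) (Multiplicative.ofAdd.injective hk)
    simp only [zsmul_eq_mul, map_mul, map_intCast, map_natCast, CharP.cast_eq_zero,
      mul_zero] at h1
    exact (ZMod.natCast_eq_zero_iff q p).1 h1.symm
  · rintro ⟨k, rfl⟩
    rw [pow_mul]
    exact Subgroup.pow_mem _ (Subgroup.mem_zpowers _) _

/-- An element of the cyclic group of order `m` is a generator or lies in a subgroup of prime
index. -/
theorem zpowers_eq_top_or_mem_zpowers (m : ℕ) [NeZero m] (c : Multiplicative (ZMod m)) :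
    Subgroup.zpowers c = ⊤ ∨
      ∃ p ∈ m.primeFactors, c ∈ Subgroup.zpowers (cyclicGen m ^ p) := by
  obtain ⟨k, -, rfl⟩ := exists_cyclicGen_pow m c
  by_cases h : Nat.Coprime k m
  · left
    have hfin : Finite (Multiplicative (ZMod m)) := inferInstance
    rw [← Subgroup.card_eq_iff_eq_top, Nat.card_zpowers, card_multiplicative_zmod]
    have h1 : orderOf (cyclicGen m) = m := by
      rw [orderOf_ofAdd_eq_addOrderOf, ZMod.addOrderOf_one]
    rw [Nat.Coprime.orderOf_pow (by rw [h1]; exact h.symm), h1]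
  · right
    obtain ⟨p, hp, hpk, hpm⟩ := Nat.Prime.not_coprime_iff_dvd.1 h
    exact ⟨p, Nat.mem_primeFactors.2 ⟨hp, hpm, NeZero.ne m⟩,
      (cyclicGen_pow_mem_zpowers_iff hpm k).2 hpk⟩

theorem zpowers_cyclicGen_pow_ne_top {m p : ℕ} (hp : p ∈ m.primeFactors) :
    Subgroup.zpowers (cyclicGen m ^ p) ≠ ⊤ := by
  intro h
  have h1 : cyclicGen m ^ 1 ∈ Subgroup.zpowers (cyclicGen m ^ p) := by rw [h]; trivial
  rw [cyclicGen_pow_mem_zpowers_iff (Nat.dvd_of_mem_primeFactors hp)] at h1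
  exact (Nat.prime_of_mem_primeFactors hp).one_lt.ne' (Nat.dvd_one.1 h1)

/-- The subgroup of `S ≀ C_m` of index `p` containing the base group, for `p` dividing `m`. -/
def overBase (S : Type*) [Group S] (m p : ℕ) : Subgroup (CyclicWreath S m) :=
  (Subgroup.zpowers (cyclicGen m ^ p)).comap RegularWreathProduct.rightHom

theorem mem_overBase {S : Type*} [Group S] {m p : ℕ} {z : CyclicWreath S m} :
    z ∈ overBase S m p ↔ z.right ∈ Subgroup.zpowers (cyclicGen m ^ p) := Iff.rfl

theorem overBase_ne_top {S : Type*} [Group S] {m p : ℕ} (hp : p ∈ m.primeFactors) :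
    overBase S m p ≠ ⊤ := by
  intro h
  apply zpowers_cyclicGen_pow_ne_top hp
  rw [Subgroup.eq_top_iff']
  intro c
  have : (⟨1, c⟩ : CyclicWreath S m) ∈ overBase S m p := by rw [h]; trivial
  exact this

theorem coveringNumber_cyclicWreath_le {S : Type*} [Group S] [Finite S] (m : ℕ) [NeZero m]
    (𝓝 : Finset (Subgroup S)) (h𝓝 : IsCovering (𝓝 : Set (Subgroup S))) :
    coveringNumber (CyclicWreath S m) ≤
      ((numPrimeDivisors m + ∑ M ∈ 𝓝, M.index ^ (m - 1) : ℕ) : ℕ∞) := by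
  classical
  let Q := Multiplicative (ZMod m)
  have : Finite (Subgroup (CyclicWreath S m)) := inferInstance
  -- Fixing the value at 1 leaves m - 1 free coordinates, whence the exponent.
  let ext (M : Subgroup S) (g : {c : Q // c ≠ 1} → S ⧸ M) : Q → S ⧸ M :=
    fun c => if h : c = 1 then ((1 : S) : S ⧸ M) else g ⟨c, h⟩
  let F (M : Subgroup S) : Set (Subgroup (CyclicWreath S m)) :=
    Set.range fun g => RegularWreathProduct.funStab (ext M g)
  let P : Set (Subgroup (CyclicWreath S m)) := overBase S m '' (m.primeFactors : Set ℕ)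
  have hcard : ∀ M : Subgroup S, (F M).encard ≤ ((M.index ^ (m - 1) : ℕ) : ℕ∞) := by
    intro M
    have h1 : (F M).encard ≤ (Set.univ : Set ({c : Q // c ≠ 1} → S ⧸ M)).encard := by
      rw [show F M = _ from Set.image_univ.symm]
      exact Set.encard_image_le _ _
    refine h1.trans (le_of_eq ?_)
    rw [Set.encard_univ, ENat.card_eq_coe_natCard, Nat.card_fun, ← Subgroup.index,
      Nat.card_eq_fintype_card (α := {c : Q // c ≠ 1}),
      Fintype.card_subtype_compl, Fintype.card_subtype_eq, ← Nat.card_eq_fintype_card,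
      card_multiplicative_zmod]
  have hcov : IsCovering (P ∪ ⋃ M ∈ 𝓝, F M) := by
    refine ⟨?_, ?_⟩
    · rintro H (⟨p, hp, rfl⟩ | hH)
      · exact overBase_ne_top hp
      · simp only [Set.mem_iUnion] at hH
        obtain ⟨M, hM, g, rfl⟩ := hH
        exact RegularWreathProduct.funStab_ne_top (h𝓝.1 M hM) _
    · rw [Set.eq_univ_iff_forall]
      intro z
      rcases zpowers_eq_top_or_mem_zpowers m z.right with h | ⟨p, hp, h⟩
      · have hz : (z ^ Nat.card Q).left 1 ∈ ⋃ H ∈ (𝓝 : Set (Subgroup S)), (H : Set S) := by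
          rw [h𝓝.2]; trivial
        simp only [Set.mem_iUnion] at hz
        obtain ⟨M, hM, hz⟩ := hz
        obtain ⟨f, hf1, hf⟩ := RegularWreathProduct.exists_mem_funStab z h hz
        refine Set.mem_biUnion (x := RegularWreathProduct.funStab f) (Or.inr ?_) hf
        simp only [Set.mem_iUnion]
        refine ⟨M, hM, fun c => f c.1, ?_⟩
        refine congrArg RegularWreathProduct.funStab ?_
        funext c
        by_cases hc : c = 1
        · simp [ext, hc, hf1]
        · simp [ext, hc]
      · exact Set.mem_biUnion (x := overBase S m p) (Or.inl ⟨p, hp, rfl⟩) h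
  refine (iInf₂_le _ hcov).trans ?_
  refine (Set.encard_union_le _ _).trans ?_
  push_cast
  refine add_le_add ?_ ?_
  · refine (Set.encard_image_le _ _).trans (le_of_eq ?_)
    rw [Set.encard_coe_eq_coe_finsetCard]; rfl
  · clear hcov h𝓝
    induction 𝓝 using Finset.induction_on with
    | empty => simp
    | insert M 𝓝 hM ih =>
      rw [Finset.sum_insert hM, Finset.set_biUnion_insert]
      refine (Set.encard_union_le _ _).trans (add_le_add ?_ ih)
      simpa using hcard M

/-! ### Subdirect subgroups of powers of a simple group. -/

/-- A subgroup of a finite power of a nonabelian simple group that projects onto each factor, and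
whose elements trivial in one given coordinate are not all trivial in another one, is everything. -/
theorem Subgroup.eq_top_of_subdirect {D Q : Type*} [Group D] [IsSimpleGroup D] [Finite Q]
    (hD : ∃ a b : D, a * b ≠ b * a) (L : Subgroup (Q → D))
    (hsub : ∀ c s, ∃ x ∈ L, x c = s) (hker : ∀ a b, a ≠ b → ∃ x ∈ L, x a = 1 ∧ x b ≠ 1) :
    L = ⊤ := by
  classical
  have := Fintype.ofFinite Q
  -- The values at c of the members of L trivial on F. By `hsub` they form a normal subgroup of D,
  -- so each is trivial or everything; growing F to all other coordinates shows that L contains each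
  -- factor.
  let N (F : Finset Q) (c : Q) : Subgroup D :=
    { carrier := {s | ∃ x ∈ L, x c = s ∧ ∀ a ∈ F, x a = 1}
      one_mem' := ⟨1, L.one_mem, rfl, fun _ _ => rfl⟩
      mul_mem' := by
        rintro s t ⟨x, hx, rfl, hx'⟩ ⟨y, hy, rfl, hy'⟩
        exact ⟨x * y, L.mul_mem hx hy, rfl, fun a ha => by simp [hx' a ha, hy' a ha]⟩
      inv_mem' := by
        rintro s ⟨x, hx, rfl, hx'⟩
        exact ⟨x⁻¹, L.inv_mem hx, rfl, fun a ha => by simp [hx' a ha]⟩ }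
  have hnorm : ∀ F c, (N F c).Normal := by
    refine fun F c => ⟨?_⟩
    rintro s ⟨x, hx, rfl, hx'⟩ g
    obtain ⟨y, hy, rfl⟩ := hsub c g
    exact ⟨y * x * y⁻¹, L.mul_mem (L.mul_mem hy hx) (L.inv_mem hy), rfl,
      fun a ha => by simp [hx' a ha]⟩
  have hpair : ∀ a b, a ≠ b → ∀ s, ∃ x ∈ L, x b = s ∧ x a = 1 := by
    intro a b hab s
    rcases (hnorm {a} b).eq_bot_or_eq_top with h | h
    · obtain ⟨x, hx, hxa, hxb⟩ := hker a b hab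
      have : x b ∈ N {a} b := ⟨x, hx, rfl, by simpa using hxa⟩
      rw [h, Subgroup.mem_bot] at this
      exact absurd this hxb
    · have : s ∈ N {a} b := by rw [h]; trivial
      obtain ⟨x, hx, hxs, hxa⟩ := this
      exact ⟨x, hx, hxs, hxa a (by simp)⟩
  have hfull : ∀ (F : Finset Q) (c : Q), c ∉ F → N F c = ⊤ := by
    intro F c
    induction F using Finset.induction_on with
    | empty =>
      intro _
      rw [Subgroup.eq_top_iff']
      intro s
      obtain ⟨x, hx, hs⟩ := hsub c s
      exact ⟨x, hx, hs, by simp⟩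
    | insert a F ha ih =>
      intro hc
      rw [Finset.mem_insert, not_or] at hc
      rcases (hnorm (insert a F) c).eq_bot_or_eq_top with h | h
      -- Commutators of a member trivial on F with a member trivial at a are trivial on both, while
      -- the two values at c are arbitrary.
      · obtain ⟨s, t, hst⟩ := hD
        have hs : s ∈ N F c := by rw [ih hc.2]; trivial
        obtain ⟨x, hx, rfl, hxF⟩ := hs
        obtain ⟨y, hy, rfl, hya⟩ := hpair a c (Ne.symm hc.1) t
        have hm : x c * y c * (x c)⁻¹ * (y c)⁻¹ ∈ N (insert a F) c := by
          refine ⟨x * y * x⁻¹ * y⁻¹,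
            L.mul_mem (L.mul_mem (L.mul_mem hx hy) (L.inv_mem hx)) (L.inv_mem hy), rfl, ?_⟩
          intro b hb
          rw [Finset.mem_insert] at hb
          rcases hb with rfl | hb
          · simp [hya]
          · simp [hxF b hb]
        rw [h, Subgroup.mem_bot, mul_inv_eq_one, mul_inv_eq_iff_eq_mul] at hm
        exact absurd hm hst
      · exact h
  rw [Subgroup.eq_top_iff']
  intro x
  refine Subgroup.pi_mem_of_mulSingle_mem x fun c => ?_
  have : x c ∈ N (Finset.univ.erase c) c := by rw [hfull _ _ (by simp)]; trivial
  obtain ⟨y, hy, hyc, hy'⟩ := this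
  have : Pi.mulSingle c (x c) = y := by
    funext b
    by_cases hb : b = c
    · subst hb; simp [hyc]
    · rw [Pi.mulSingle_eq_of_ne hb, hy' b (by simp [hb])]
  rwa [this]

/-! ### Maximal subgroups of the wreath product. -/

namespace RegularWreathProduct

variable {D Q : Type*} [Group D] [Group Q]

/-- The inclusion of the base group. -/
def baseHom : (Q → D) →* D ≀ᵣ Q where
  toFun x := ⟨x, 1⟩
  map_one' := rfl
  map_mul' x y := by ext <;> simp

/-- The intersection of a subgroup with the base group. -/
def basePart (K : Subgroup (D ≀ᵣ Q)) : Subgroup (Q → D) := K.comap baseHom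

theorem mem_basePart {K : Subgroup (D ≀ᵣ Q)} {x : Q → D} :
    x ∈ basePart K ↔ (⟨x, 1⟩ : D ≀ᵣ Q) ∈ K := Iff.rfl

theorem conj_mem_basePart {K : Subgroup (D ≀ᵣ Q)} {z : D ≀ᵣ Q} (hz : z ∈ K) {x : Q → D}
    (hx : x ∈ basePart K) :
    (fun c => z.left c * x (z.right⁻¹ * c) * (z.left c)⁻¹) ∈ basePart K := by
  have h := K.mul_mem (K.mul_mem hz (mem_basePart.1 hx)) (K.inv_mem hz)
  rw [mem_basePart]
  convert h using 1
  ext <;> simp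

theorem basePart_eq_top_iff {K : Subgroup (D ≀ᵣ Q)} :
    basePart K = ⊤ ↔ (rightHom : D ≀ᵣ Q →* Q).ker ≤ K := by
  rw [Subgroup.eq_top_iff']
  constructor
  · rintro h ⟨x, c⟩ (hc : c = 1)
    subst hc
    exact h x
  · intro h x
    exact h (show (⟨x, 1⟩ : D ≀ᵣ Q).right = 1 from rfl)

/-- A maximal subgroup not containing the base group supplements it. -/
theorem exists_mem_right_eq {K : Subgroup (D ≀ᵣ Q)} (hK : IsCoatom K) (h : basePart K ≠ ⊤)
    (c : Q) : ∃ z ∈ K, z.right = c := by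
  have hsurj : Function.Surjective (rightHom : D ≀ᵣ Q →* Q) := fun c => ⟨⟨1, c⟩, rfl⟩
  have hle : K ≤ (K.map rightHom).comap rightHom := Subgroup.le_comap_map _ _
  rcases hle.eq_or_lt with h1 | h1
  · exfalso
    apply h
    rw [basePart_eq_top_iff, h1]
    intro z hz
    rw [Subgroup.mem_comap, MonoidHom.mem_ker.1 hz]
    exact one_mem _
  · have h2 := hK.2 _ h1
    have h3 : (⟨1, c⟩ : D ≀ᵣ Q) ∈ (K.map rightHom).comap rightHom := by rw [h2]; trivial
    obtain ⟨z, hz, hzc⟩ := h3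
    exact ⟨z, hz, hzc⟩

/-- A subgroup supplementing the base group and meeting it in a proper subdirect subgroup has a
small intersection with it. -/
theorem exists_card_basePart_le [IsSimpleGroup D] [Finite D] [Finite Q]
    (hD : ∃ a b : D, a * b ≠ b * a) {K : Subgroup (D ≀ᵣ Q)}
    (hK : ∀ c : Q, ∃ z ∈ K, z.right = c) (h : basePart K ≠ ⊤)
    (hsub : ∀ c s, ∃ x ∈ basePart K, x c = s) :
    ∃ T : Subgroup Q, T ≠ ⊥ ∧ Nat.card (basePart K) ≤ Nat.card D ^ T.index := by
  classical
  -- Conjugation by K, which maps onto Q, makes this relation translation invariant, so the t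
  -- related to 1 form a subgroup T. If T is trivial the base part is everything.
  let rel (a b : Q) : Prop := ∀ x ∈ basePart K, x a = 1 → x b = 1
  have hshift : ∀ δ a b, rel a b → rel (δ * a) (δ * b) := by
    intro δ a b hab x hx hxa
    obtain ⟨z, hz, hzr⟩ := hK δ⁻¹
    have h1 := hab _ (conj_mem_basePart hz hx)
    simp only [hzr, inv_inv, hxa, mul_one, mul_inv_cancel, forall_const, conj_eq_one_iff] at h1
    exact h1
  have hpow : ∀ t, rel 1 t → ∀ k : ℕ, rel 1 (t ^ k) := by
    intro t ht k
    induction k with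
    | zero => intro x _ h; simpa using h
    | succ k ih =>
      intro x hx hx1
      rw [pow_succ']
      have h1 := hshift t 1 (t ^ k) ih
      rw [mul_one] at h1
      exact h1 x hx (ht x hx hx1)
  let T : Subgroup Q :=
    { carrier := {t | rel 1 t}
      one_mem' := fun x _ h => h
      mul_mem' := by
        intro s t hs ht x hx hx1
        have h1 := hshift s 1 t ht
        rw [mul_one] at h1
        exact h1 x hx (hs x hx hx1)
      inv_mem' := by
        intro t ht
        -- The relation is not symmetric by definition; finite order replaces the inverse by a
        -- power.
        have h1 : t⁻¹ = t ^ (orderOf t - 1) := by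
          rw [inv_eq_iff_mul_eq_one, ← pow_succ', Nat.sub_add_cancel (orderOf_pos t),
            pow_orderOf_eq_one]
        change rel 1 t⁻¹
        rw [h1]
        exact hpow t ht _ }
  refine ⟨T, ?_, ?_⟩
  · intro hT
    apply h
    refine Subgroup.eq_top_of_subdirect hD _ hsub fun a b hab => ?_
    by_contra hcon
    push Not at hcon
    have h1 : rel 1 (a⁻¹ * b) := by
      have := hshift a⁻¹ a b hcon
      rwa [inv_mul_cancel] at this
    have h2 : a⁻¹ * b ∈ T := h1
    rw [hT, Subgroup.mem_bot, inv_mul_eq_one] at h2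
    exact hab h2
  -- An element of the base part trivial at one point of a coset of T is trivial on the whole coset,
  -- so values at representatives determine it.
  · let F : basePart K → (Q ⧸ T → D) := fun x q => x.1 q.out
    have hF : Function.Injective F := by
      intro x y hxy
      ext c
      have h1 := congrFun hxy (c : Q ⧸ T)
      obtain ⟨t, ht⟩ := QuotientGroup.mk_out_eq_mul T c
      have h2 := hshift (c : Q ⧸ T).out 1 t⁻¹ (T.inv_mem t.2)
      rw [mul_one, ht, mul_inv_cancel_right] at h2
      have h3 := h2 (x.1 * y.1⁻¹) ((basePart K).mul_mem x.2 ((basePart K).inv_mem y.2))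
      rw [← ht] at h3
      have h4 : x.1 (c : Q ⧸ T).out = y.1 (c : Q ⧸ T).out := h1
      simp only [Pi.mul_apply, Pi.inv_apply, mul_inv_eq_one] at h3
      exact h3 h4
    have := Nat.card_le_card_of_injective F hF
    rwa [Nat.card_fun] at this

/-- A subgroup supplementing the base group but not containing it fixes a point of a product
action on the cosets of a proper subgroup, or has a small intersection with the base group. -/
theorem le_funStab_or_card_basePart_le [IsSimpleGroup D] [Finite D] [Finite Q] [Nontrivial Q]
    (hD : ∃ a b : D, a * b ≠ b * a) {K : Subgroup (D ≀ᵣ Q)}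
    (hK : ∀ c : Q, ∃ z ∈ K, z.right = c) (h : basePart K ≠ ⊤) :
    (∃ R : Subgroup D, R ≠ ⊤ ∧ ∃ f : Q → D ⧸ R, K ≤ funStab f) ∨
      ∃ T : Subgroup Q, T ≠ ⊥ ∧ Nat.card (basePart K) ≤ Nat.card D ^ T.index := by
  classical
  -- Conjugation by z in K carries the projection at `z.right⁻¹ * c` onto the projection at c, so
  -- all projections are conjugate. They are full, trivial, or proper and nontrivial.
  let P (c : Q) : Subgroup D := (basePart K).map (Pi.evalMonoidHom _ c)
  have hP : ∀ z ∈ K, ∀ c s, s ∈ P (z.right⁻¹ * c) ↔ z.left c * s * (z.left c)⁻¹ ∈ P c := by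
    have key : ∀ z ∈ K, ∀ c s, s ∈ P (z.right⁻¹ * c) → z.left c * s * (z.left c)⁻¹ ∈ P c := by
      rintro z hz c s ⟨x, hx, rfl⟩
      exact ⟨_, conj_mem_basePart hz hx, rfl⟩
    intro z hz c s
    refine ⟨key z hz c s, fun hs => ?_⟩
    have h1 := key z⁻¹ (K.inv_mem hz) (z.right⁻¹ * c) (z.left c * s * (z.left c)⁻¹)
      (by simpa using hs)
    simpa [mul_assoc] using h1
  by_cases htop : P 1 = ⊤
  · right
    refine exists_card_basePart_le hD hK h fun c s => ?_
    obtain ⟨z, hz, rfl⟩ := hK c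
    have h1 : (z.left z.right)⁻¹ * s * z.left z.right ∈ P (z.right⁻¹ * z.right) := by
      rw [inv_mul_cancel, htop]; trivial
    rw [hP z hz] at h1
    simp only [mul_assoc, mul_inv_cancel, mul_one, mul_inv_cancel_left] at h1
    obtain ⟨x, hx, hxs⟩ := h1
    exact ⟨x, hx, hxs⟩
  by_cases hbot : P 1 = ⊥
  · right
    refine ⟨⊤, top_ne_bot, ?_⟩
    have : basePart K = ⊥ := by
      rw [Subgroup.eq_bot_iff_forall]
      intro x hx
      funext c
      obtain ⟨z, hz, rfl⟩ := hK c
      have h1 : z.left z.right * ((z.left z.right)⁻¹ * x z.right * z.left z.right) *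
          (z.left z.right)⁻¹ ∈ P z.right := by
        simp only [mul_assoc, mul_inv_cancel, mul_one, mul_inv_cancel_left]
        exact ⟨x, hx, rfl⟩
      rw [← hP z hz, inv_mul_cancel, hbot, Subgroup.mem_bot] at h1
      have h2 : x z.right = 1 := by
        have := congrArg (fun s => z.left z.right * s * (z.left z.right)⁻¹) h1
        simpa [mul_assoc] using this
      exact h2
    rw [this]
    simpa using Nat.one_le_iff_ne_zero.2 Nat.card_pos.ne'
  · left
    choose z hz hzc using hK
    -- Take R to be the normalizer of `P 1`, proper by simplicity. The coset f(c) consists of the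
    -- elements conjugating `P 1` onto `P c`, so K fixes f because it permutes the projections.
    refine ⟨Subgroup.normalizer (P 1 : Set D), fun hn => ?_, fun c => ((z c).left c : D), ?_⟩
    · have h1 := (Subgroup.normalizer_eq_top_iff.1 hn).eq_bot_or_eq_top
      tauto
    · intro w hw c
      rw [MulAction.Quotient.smul_mk, QuotientGroup.eq, Subgroup.mem_normalizer_iff]
      intro s
      have e1 := hP (z c) (hz c) c
      rw [hzc, inv_mul_cancel] at e1
      have e2 := hP (z (w.right⁻¹ * c)) (hz _) (w.right⁻¹ * c)
      rw [hzc, inv_mul_cancel] at e2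
      have e3 := hP w hw c
      have e4 := e2 (((w.left c * (z (w.right⁻¹ * c)).left (w.right⁻¹ * c))⁻¹ * (z c).left c) * s *
        ((w.left c * (z (w.right⁻¹ * c)).left (w.right⁻¹ * c))⁻¹ * (z c).left c)⁻¹)
      rw [smul_eq_mul, e4, e3, e1]
      simp [mul_assoc]

end RegularWreathProduct

/-- K is the preimage of its cyclic image. A generator of that image either generates the quotient,
which properness forbids, or lies in a subgroup of prime index, and maximality gives equality. -/
theorem exists_overBase_of_basePart_eq_top {S : Type*} [Group S] {m : ℕ} [NeZero m]
    {K : Subgroup (CyclicWreath S m)} (hK : IsCoatom K)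
    (h : RegularWreathProduct.basePart K = ⊤) : ∃ p ∈ m.primeFactors, K = overBase S m p := by
  rw [RegularWreathProduct.basePart_eq_top_iff] at h
  have hK' : (K.map RegularWreathProduct.rightHom).comap RegularWreathProduct.rightHom = K :=
    Subgroup.comap_map_eq_self h
  obtain ⟨c, hc⟩ := IsCyclic.exists_zpow_surjective
    (G := (K.map (RegularWreathProduct.rightHom : CyclicWreath S m →* _)))
  have hle : ∀ p, c.1 ∈ Subgroup.zpowers (cyclicGen m ^ p) → K ≤ overBase S m p := by
    intro p hp z hz
    obtain ⟨k, hk⟩ := hc ⟨z.right, z, hz, rfl⟩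
    have hk' := congrArg Subtype.val hk
    rw [mem_overBase]
    have : z.right = c.1 ^ k := by simpa using hk'.symm
    rw [this]
    exact Subgroup.zpow_mem _ hp _
  rcases zpowers_eq_top_or_mem_zpowers m c.1 with h1 | ⟨p, hp, h1⟩
  · exfalso
    apply hK.1
    rw [← hK', eq_top_iff]
    intro z _
    have h2 : z.right ∈ Subgroup.zpowers c.1 := by rw [h1]; trivial
    obtain ⟨k, hk⟩ := h2
    have := Subgroup.zpow_mem _ c.2 k
    rw [Subgroup.mem_comap]
    change z.right ∈ _
    rw [← hk]
    exact this
  · refine ⟨p, hp, ?_⟩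
    rcases (hle p h1).eq_or_lt with h2 | h2
    · exact h2
    · exact absurd (hK.2 _ h2) (overBase_ne_top hp)

/-! ### Covering by boxes of proper subgroups. -/

section BoxCover

variable {S I : Type*} [Group S] [Fintype I]

open Classical in
/-- The number of boxes, weighted by the indices of their sides, whose sides in the coordinates
from `J` contain the prescribed elements. -/
noncomputable def boxCount {ι : Type*} (R : I → ι → Subgroup S) (J : Finset ι) (g : ι → S) : ℕ :=
  ∑ k, ∏ j ∈ J, if g j ∈ R k j then (R k j).index else 0

theorem Subgroup.two_mul_card_le [Finite S] {R : Subgroup S} (hR : R ≠ ⊤) :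
    2 * Nat.card R ≤ Nat.card S := by
  have h1 := R.card_mul_index
  have h2 : R.index ≠ 1 := fun h => hR (Subgroup.index_eq_one.1 h)
  have h3 : R.index ≠ 0 := Subgroup.index_ne_zero_of_finite
  have h4 : 2 ≤ R.index := by omega
  rw [← h1, mul_comm]
  exact Nat.mul_le_mul_left _ h4

open Classical in
theorem Subgroup.sum_ite_mem [Fintype S] (R : Subgroup S) (a : ℕ) :
    ∑ y : S, (if y ∈ R then a else 0) = Nat.card R * a := by
  rw [← Finset.sum_filter, Finset.sum_const, smul_eq_mul, Nat.card_eq_fintype_card,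
    Fintype.card_subtype]

open Classical in
/-- A weighted family of proper subgroups, each weight multiplied by the index, covers some element
with total weight less than the total weight of the family. -/
theorem exists_sum_index_lt [Finite S] (R : I → Subgroup S) (hR : ∀ k, R k ≠ ⊤) (a : I → ℕ)
    (ha : ∑ k, a k ≠ 0) :
    ∃ y : S, ∑ k, a k * (if y ∈ R k then (R k).index else 0) < ∑ k, a k := by
  have := Fintype.ofFinite S
  -- Averaged over y, an indicator times its index contributes exactly 1, whereas at y = 1 the sum
  -- strictly exceeds the total weight. Some y must fall below it.
  by_contra! hcon
  have h1 : ∑ _y : S, ∑ k, a k <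
      ∑ y : S, ∑ k, a k * (if y ∈ R k then (R k).index else 0) := by
    refine Finset.sum_lt_sum (fun y _ => hcon y) ⟨1, Finset.mem_univ _, ?_⟩
    obtain ⟨k, -, hk⟩ := Finset.exists_ne_zero_of_sum_ne_zero ha
    have hidx : ∀ k, 1 < (R k).index := fun k =>
      Nat.one_lt_iff_ne_zero_and_ne_one.2
        ⟨Subgroup.index_ne_zero_of_finite, fun h => hR k (Subgroup.index_eq_one.1 h)⟩
    refine Finset.sum_lt_sum (fun k _ => ?_) ⟨k, Finset.mem_univ _, ?_⟩
    · simpa [one_mem] using Nat.le_mul_of_pos_right (a k) (zero_lt_one.trans (hidx k))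
    · simpa [one_mem] using (Nat.lt_mul_iff_one_lt_right (Nat.pos_of_ne_zero hk)).2 (hidx k)
  have h2 : ∑ y : S, ∑ k, a k * (if y ∈ R k then (R k).index else 0) =
      ∑ k, a k * Nat.card S := by
    rw [Finset.sum_comm]
    simp only [← Finset.mul_sum, Subgroup.sum_ite_mem, Subgroup.card_mul_index]
  rw [h2, ← Finset.sum_mul, Finset.sum_const, Finset.card_univ, smul_eq_mul,
    Nat.card_eq_fintype_card, mul_comm] at h1
  exact lt_irrefl _ h1

/-- Coordinates are chosen greedily: by `exists_sum_index_lt`, each new one can lower a nonzero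
count by at least 1. -/
theorem exists_boxCount_add_card_le [Finite S] {ι : Type*} (R : I → ι → Subgroup S)
    (hR : ∀ k j, R k j ≠ ⊤) (J : Finset ι) :
    ∃ g : ι → S, boxCount R J g = 0 ∨ boxCount R J g + J.card ≤ Fintype.card I := by
  classical
  induction J using Finset.induction_on with
  | empty => exact ⟨1, by simp [boxCount]⟩
  | insert i J hi ih =>
    obtain ⟨g, hg⟩ := ih
    have hup : ∀ y, boxCount R (insert i J) (Function.update g i y) =
        ∑ k, (∏ j ∈ J, if g j ∈ R k j then (R k j).index else 0) *
          (if y ∈ R k i then (R k i).index else 0) := by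
      intro y
      refine Finset.sum_congr rfl fun k _ => ?_
      rw [Finset.prod_insert hi, mul_comm, Function.update_self]
      congr 1
      refine Finset.prod_congr rfl fun j hj => ?_
      rw [Function.update_of_ne (fun h : j = i => hi (h ▸ hj))]
    by_cases h0 : boxCount R J g = 0
    · refine ⟨Function.update g i 1, Or.inl ?_⟩
      rw [hup]
      rw [boxCount, Finset.sum_eq_zero_iff] at h0
      exact Finset.sum_eq_zero fun k hk => by rw [h0 k hk, zero_mul]
    · obtain ⟨y, hy⟩ := exists_sum_index_lt (fun k => R k i) (fun k => hR k i)
        (fun k => ∏ j ∈ J, if g j ∈ R k j then (R k j).index else 0) h0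
      refine ⟨Function.update g i y, Or.inr ?_⟩
      rw [hup, Finset.card_insert_of_notMem hi]
      have h1 := hg.resolve_left h0
      rw [boxCount] at h1
      omega

open Classical in
/-- Lower bound for the number of boxes with proper subgroups as sides which, together with `d`
sets of total weight `E`, cover a space of weight `T` as evenly as expressed by `hcover`. -/
theorem add_le_card_add_of_box_cover [Finite S] {n : ℕ} (R : I → Fin n → Subgroup S)
    (hR : ∀ k j, R k j ≠ ⊤) {T b d α : ℕ} {E : ℚ}
    (hcover : ∀ Y : Fin n → Finset S, (T : ℚ) * ∏ j, ((Y j).card / Nat.card S : ℚ) ≤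
      ∑ k, ∏ j, (((Y j).filter (· ∈ R k j)).card / Nat.card (R k j) : ℚ) + E)
    (hs2 : 2 ≤ Nat.card S) (hT : 1 ≤ T) (hE : E * (1 + α) ≤ d) (hbα : b ≤ α) (hbn : b ≤ n)
    (hsmall : 1 ≤ d → d < b → T < b * Nat.card S → E * (Nat.card S : ℚ) ^ (b - d) < 1) :
    T + b ≤ Fintype.card I + d := by
  have := Fintype.ofFinite S
  have hs : (0 : ℚ) < Nat.card S := by exact_mod_cast Nat.card_pos
  have hr : ∀ k j, (0 : ℚ) < Nat.card (R k j) := fun k j => by exact_mod_cast Nat.card_pos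
  have hfilter : ∀ k j, ((Finset.univ : Finset S).filter (· ∈ R k j)).card = Nat.card (R k j) :=
    fun k j => by rw [Nat.card_eq_fintype_card, Fintype.card_subtype]
  have hEd : E ≤ d := by
    by_contra! h
    have h1 : (0 : ℚ) ≤ d := Nat.cast_nonneg d
    have h2 : (0 : ℚ) ≤ α := Nat.cast_nonneg α
    nlinarith
  by_contra! hcon
  -- With b ≤ d the unrestricted cover suffices, since E is at most d / (1 + α) and b ≤ α.
  rcases le_or_gt b d with hbd | hbd
  · have h1 := hcover fun _ => Finset.univ
    simp only [hfilter, Finset.card_univ, ← Nat.card_eq_fintype_card (α := S)] at h1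
    simp only [div_self hs.ne', div_self (hr _ _).ne', Finset.prod_const_one, mul_one,
      Finset.sum_const, Finset.card_univ, nsmul_eq_mul] at h1
    have h2 : (Fintype.card I + d + 1 : ℚ) ≤ T + b := by exact_mod_cast hcon
    have h3 : (b : ℚ) ≤ d := by exact_mod_cast hbd
    have h4 : (b : ℚ) ≤ α := by exact_mod_cast hbα
    have h5 : (0 : ℚ) ≤ α := Nat.cast_nonneg α
    have h6 : (d + 1 - b : ℚ) ≤ E := by linarith
    have h7 : (d + 1 - b : ℚ) * (1 + α) ≤ d := (mul_le_mul_of_nonneg_right h6 (by linarith)).trans hE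
    nlinarith
  have hn : 0 < n := by omega
  -- For large T, delete the identity from one coordinate: the space loses the proportion 1/|S|,
  -- each box at least 2/|S|. This gain, multiplied by T, outweighs b.
  by_cases hbig : 1 ≤ d ∧ b * Nat.card S ≤ T
  · obtain ⟨-, hbig⟩ := hbig
    let j₀ : Fin n := ⟨0, hn⟩
    have h1 := hcover (Function.update (fun _ => Finset.univ) j₀ (Finset.univ.erase 1))
    have e1 : ∏ j, ((Function.update (fun _ => Finset.univ) j₀
        ((Finset.univ : Finset S).erase 1) j).card / Nat.card S : ℚ) =
        (Nat.card S - 1) / Nat.card S := by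
      rw [Finset.prod_eq_single j₀ _ (by simp)]
      · rw [Function.update_self, Finset.card_erase_of_mem (Finset.mem_univ _),
          Finset.card_univ, ← Nat.card_eq_fintype_card, Nat.cast_sub Nat.card_pos, Nat.cast_one]
      · intro j _ hj
        rw [Function.update_of_ne hj, Finset.card_univ, ← Nat.card_eq_fintype_card,
          div_self hs.ne']
    have e2 : ∀ k, ∏ j, (((Function.update (fun _ => Finset.univ) j₀
        ((Finset.univ : Finset S).erase 1) j).filter (· ∈ R k j)).card / Nat.card (R k j) : ℚ) ≤
        1 - 2 / Nat.card S := by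
      intro k
      rw [Finset.prod_eq_single j₀ _ (by simp)]
      · rw [Function.update_self, Finset.filter_erase,
          Finset.card_erase_of_mem (by simp [one_mem]), hfilter,
          Nat.cast_sub Nat.card_pos, Nat.cast_one, sub_div, div_self (hr _ _).ne']
        have h2 : (2 * Nat.card (R k j₀) : ℚ) ≤ Nat.card S := by
          exact_mod_cast Subgroup.two_mul_card_le (hR k j₀)
        have h3 : (2 / Nat.card S : ℚ) ≤ 1 / Nat.card (R k j₀) := by
          rw [div_le_div_iff₀ hs (hr _ _)]
          linarith
        linarith
      · intro j _ hj
        rw [Function.update_of_ne hj, hfilter, div_self (hr _ _).ne']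
    rw [e1] at h1
    have h2 := h1.trans (add_le_add_left (Finset.sum_le_sum fun k _ => e2 k) E)
    rw [Finset.sum_const, Finset.card_univ, nsmul_eq_mul] at h2
    have h3 : (Fintype.card I + d + 1 : ℚ) ≤ T + b := by exact_mod_cast hcon
    have h4 : (b * Nat.card S : ℚ) ≤ T := by exact_mod_cast hbig
    have h5 : (d + 1 : ℚ) ≤ b := by exact_mod_cast hbd
    have h6 : (T : ℚ) * (Nat.card S - 1) ≤
        Fintype.card I * (Nat.card S - 2) + E * Nat.card S := by
      have := mul_le_mul_of_nonneg_right h2 hs.le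
      field_simp at this
      linarith
    have h7 : (2 : ℚ) ≤ Nat.card S := by exact_mod_cast hs2
    have h8 : (Fintype.card I : ℚ) * (Nat.card S - 2) ≤ (T + b - d - 1) * (Nat.card S - 2) :=
      mul_le_mul_of_nonneg_right (by linarith) (by linarith)
    have h9 : E * Nat.card S ≤ d * Nat.card S := mul_le_mul_of_nonneg_right hEd hs.le
    nlinarith
  · have hD : E * (Nat.card S : ℚ) ^ (b - d) < 1 := by
      rcases Nat.eq_zero_or_pos d with h0 | h0
      · have : E ≤ 0 := by simpa [h0] using hEd
        exact (mul_nonpos_of_nonpos_of_nonneg this (by positivity)).trans_lt one_pos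
      · exact hsmall h0 hbd (not_le.1 fun h => hbig ⟨h0, h⟩)
    -- Otherwise freeze b - d coordinates at a greedily chosen point. After rescaling the error is
    -- below 1, so integrality gives T ≤ `boxCount R J g`, and T ≥ 1 excludes the alternative that
    -- the count is 0.
    obtain ⟨J, -, hJ⟩ := Finset.exists_subset_card_eq (s := (Finset.univ : Finset (Fin n)))
      (n := b - d) (by simp; omega)
    obtain ⟨g, hg⟩ := exists_boxCount_add_card_le R hR J
    have h1 := hcover fun j => if j ∈ J then {g j} else Finset.univ
    have e1 : ∏ j, (((if j ∈ J then {g j} else Finset.univ : Finset S)).card / Nat.card S : ℚ) =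
        1 / (Nat.card S : ℚ) ^ (b - d) := by
      rw [← hJ, ← one_div_pow, ← Finset.prod_const, ← Finset.prod_subset (Finset.subset_univ J)]
      · exact Finset.prod_congr rfl fun j hj => by simp [hj]
      · intro j _ hj
        rw [if_neg hj, Finset.card_univ, ← Nat.card_eq_fintype_card, div_self hs.ne']
    have e2 : ∀ k, ∏ j, (((if j ∈ J then {g j} else Finset.univ : Finset S).filter
        (· ∈ R k j)).card / Nat.card (R k j) : ℚ) =
        ((∏ j ∈ J, if g j ∈ R k j then (R k j).index else 0 : ℕ) : ℚ) *
          (1 / (Nat.card S : ℚ) ^ (b - d)) := by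
      intro k
      rw [← hJ, ← one_div_pow, ← Finset.prod_const, Nat.cast_prod, ← Finset.prod_mul_distrib,
        ← Finset.prod_subset (Finset.subset_univ J)]
      · refine Finset.prod_congr rfl fun j hj => ?_
        have h2 : (Nat.card (R k j) * (R k j).index : ℚ) = Nat.card S := by
          exact_mod_cast (R k j).card_mul_index
        rw [if_pos hj, Finset.filter_singleton]
        split_ifs with h
        · rw [Finset.card_singleton, ← h2]
          have h3 : ((R k j).index : ℚ) ≠ 0 := by
            exact_mod_cast Subgroup.index_ne_zero_of_finite
          have := (hr k j).ne'
          field_simp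
          norm_num
        · simp
      · intro j _ hj
        rw [if_neg hj, hfilter, div_self (hr _ _).ne']
    rw [e1, Finset.sum_congr rfl fun k _ => e2 k, ← Finset.sum_mul, ← Nat.cast_sum] at h1
    change _ ≤ (boxCount R J g : ℚ) * _ + E at h1
    have hpow : (0 : ℚ) < (Nat.card S : ℚ) ^ (b - d) := by positivity
    have h2 : (T : ℚ) ≤ boxCount R J g + E * (Nat.card S : ℚ) ^ (b - d) := by
      have := mul_le_mul_of_nonneg_right h1 hpow.le
      field_simp at this
      linarith
    have h3 : T ≤ boxCount R J g := by
      have : (T : ℚ) < boxCount R J g + 1 := by linarith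
      have : T < boxCount R J g + 1 := by exact_mod_cast this
      omega
    rcases hg with hg | hg
    · omega
    · omega

end BoxCover

/-! ### Equidistribution of cycle products. -/

namespace RegularWreathProduct

theorem pow_left_congr {D Q : Type*} [Group D] [Group Q] (x y : Q → D) (δ : Q) (l : ℕ) :
    ∀ c : Q, (∀ i < l, x ((δ ^ i)⁻¹ * c) = y ((δ ^ i)⁻¹ * c)) →
      ((⟨x, δ⟩ : D ≀ᵣ Q) ^ l).left c = ((⟨y, δ⟩ : D ≀ᵣ Q) ^ l).left c := by
  induction l with
  | zero => intro c _; rfl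
  | succ l ih =>
    intro c h
    rw [pow_succ_left', pow_succ_left', ih c fun i hi => h i (by omega)]
    exact congrArg _ (h l (by omega))

theorem card_stabilizer_quotient {D : Type*} [Group D] [Finite D] (R : Subgroup D) (a : D ⧸ R) :
    Nat.card (MulAction.stabilizer D a) = Nat.card R := by
  have h1 := (MulAction.stabilizer D a).card_mul_index
  rw [MulAction.index_stabilizer_of_transitive, ← R.card_mul_index] at h1
  exact Nat.eq_of_mul_eq_mul_right (Nat.pos_of_ne_zero Subgroup.index_ne_zero_of_finite) h1

theorem card_smul_eq {D : Type*} [Group D] [Finite D] (R : Subgroup D) (a b : D ⧸ R) :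
    Nat.card {s : D // s • a = b} = Nat.card R := by
  obtain ⟨g, hg⟩ := MulAction.exists_smul_eq D a b
  rw [← card_stabilizer_quotient R a]
  refine Nat.card_congr ((Equiv.mulLeft g⁻¹).subtypeEquiv fun s => ?_)
  rw [MulAction.mem_stabilizer_iff, Equiv.coe_mulLeft, mul_smul, inv_smul_eq_iff, hg]

theorem card_mk_mem_funStab {D Q : Type*} [Group D] [Finite D] [Group Q] [Finite Q]
    {R : Subgroup D} (f : Q → D ⧸ R) (δ : Q) :
    Nat.card {x : Q → D // (⟨x, δ⟩ : D ≀ᵣ Q) ∈ funStab f} = Nat.card R ^ Nat.card Q := by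
  have := Fintype.ofFinite Q
  have e : {x : Q → D // (⟨x, δ⟩ : D ≀ᵣ Q) ∈ funStab f} ≃
      ∀ c : Q, {s : D // s • f (δ⁻¹ * c) = f c} :=
    { toFun := fun x c => ⟨x.1 c, x.2 c⟩
      invFun := fun y => ⟨fun c => (y c).1, fun c => (y c).2⟩
      left_inv := fun _ => rfl
      right_inv := fun _ => rfl }
  rw [Nat.card_congr e, Nat.card_pi]
  simp [card_smul_eq]

end RegularWreathProduct

open RegularWreathProduct

/-- The product of the coordinates of `x` along the cycle through `j` of the `q`-th power of the
distinguished generator. -/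
def cycleProd {S : Type*} [Group S] {m : ℕ} (q : ℕ) (x : Multiplicative (ZMod m) → S) (j : Fin q) :
    S :=
  ((⟨x, cyclicGen m ^ q⟩ : CyclicWreath S m) ^ (m / q)).left (cyclicGen m ^ (j : ℕ))

/-- The function on the cyclic group with prescribed values on the first `q` powers of the
distinguished generator, and trivial elsewhere. -/
def headFun {S : Type*} [Group S] {m q : ℕ} (t : Fin q → S) (c : Multiplicative (ZMod m)) : S :=
  if h : (Multiplicative.toAdd c).val < q then t ⟨_, h⟩ else 1

theorem headFun_pow {S : Type*} [Group S] {m q : ℕ} (t : Fin q → S) {k : ℕ} (hk : k < m) :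
    headFun t (cyclicGen m ^ k) = if h : k < q then t ⟨k, h⟩ else 1 := by
  have : (Multiplicative.toAdd (cyclicGen m ^ k)).val = k := by
    rw [cyclicGen_pow, toAdd_ofAdd, ZMod.val_cast_of_lt hk]
  simp only [headFun, this]

/-- Each cycle of the q-th power of the generator meets the first q positions exactly once, and its
product starts there. Hence `headFun t` only contributes the left factor `t j`. -/
theorem cycleProd_headFun_mul {S : Type*} [Group S] {m q : ℕ} [NeZero m] (hq : q ∣ m)
    (t : Fin q → S) (x : Multiplicative (ZMod m) → S) (j : Fin q) :
    cycleProd q (headFun t * x) j = t j * cycleProd q x j := by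
  obtain ⟨k, rfl⟩ := hq
  have hq0 : 0 < q := j.pos
  have hk0 : 0 < k := Nat.pos_of_ne_zero fun h => NeZero.ne (q * k) (by simp [h])
  obtain ⟨k, rfl⟩ := Nat.exists_eq_add_one.2 hk0
  simp only [cycleProd, Nat.mul_div_cancel_left _ hq0, pow_succ_left]
  rw [pow_left_congr (headFun t * x) x]
  · have hj : (j : ℕ) < q * (k + 1) := j.2.trans_le (Nat.le_mul_of_pos_right q (by omega))
    rw [Pi.mul_apply, headFun_pow t hj, dif_pos j.2, mul_assoc]
  · intro i hi
    have hle : q * (i + 2) ≤ q * (k + 1) := Nat.mul_le_mul_left q (by omega)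
    -- The later points of the cycle are rewritten with exponents between q and m - 1, where
    -- `headFun` takes its default value 1.
    have h1 : ((cyclicGen (q * (k + 1)) ^ q) ^ i)⁻¹ * ((cyclicGen (q * (k + 1)) ^ q)⁻¹ *
        cyclicGen (q * (k + 1)) ^ (j : ℕ)) =
        cyclicGen (q * (k + 1)) ^ (j + (q * (k + 1) - q * (i + 1))) := by
      rw [inv_mul_eq_iff_eq_mul, inv_mul_eq_iff_eq_mul, ← pow_mul, ← pow_add, ← pow_add,
        cyclicGen_pow_eq_iff]
      have : q + (q * i + (j + (q * (k + 1) - q * (i + 1)))) = j + q * (k + 1) := by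
        have e1 : q * (i + 2) = q * i + q + q := by ring
        have e2 : q * (i + 1) = q * i + q := by ring
        omega
      rw [this]
      exact (Nat.add_mod_right _ _).symm
    have e1 : q * (i + 2) = q * (i + 1) + q := by ring
    have e3 := j.2
    have e4 : q ≤ q * (i + 1) := Nat.le_mul_of_pos_right q (by omega)
    rw [h1, Pi.mul_apply, headFun_pow t (by omega), dif_neg (by omega), one_mul]

theorem cycleProd_mem_stabilizer {S : Type*} [Group S] {m q : ℕ} (hq : q ∣ m)
    {R : Subgroup S} {f : Multiplicative (ZMod m) → S ⧸ R} {x : Multiplicative (ZMod m) → S}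
    (hx : (⟨x, cyclicGen m ^ q⟩ : CyclicWreath S m) ∈ funStab f) (j : Fin q) :
    cycleProd q x j ∈ MulAction.stabilizer S (f (cyclicGen m ^ (j : ℕ))) := by
  have h1 := (funStab f).pow_mem hx (m / q) (cyclicGen m ^ (j : ℕ))
  have h2 : ((⟨x, cyclicGen m ^ q⟩ : CyclicWreath S m) ^ (m / q)).right = 1 := by
    rw [pow_right, ← pow_mul, Nat.mul_div_cancel' hq, cyclicGen_pow]
    simp
  rw [h2, inv_one, one_mul] at h1
  exact h1

/-- The stabilizer of the coordinate of `f` at `c`. -/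
def coordStabilizer {S Q : Type*} [Group S] {R : Subgroup S} (f : Q → S ⧸ R) (c : Q) :
    Subgroup S :=
  MulAction.stabilizer S (f c)

theorem card_coordStabilizer {S Q : Type*} [Group S] [Finite S] {R : Subgroup S} (f : Q → S ⧸ R)
    (c : Q) : Nat.card (coordStabilizer f c) = Nat.card R :=
  card_stabilizer_quotient R (f c)

open Classical in
/-- The cycle products of the elements of a coset of the base group fixing `f` are equidistributed
in the product of the stabilizers of the coordinates of `f`. -/
theorem sum_cycleProd_mul {S : Type*} [Group S] [Fintype S] {m q : ℕ} [NeZero m] (hq : q ∣ m)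
    {R : Subgroup S} (f : Multiplicative (ZMod m) → S ⧸ R) (φ : Fin q → S → ℚ) :
    (∑ x : Multiplicative (ZMod m) → S,
      if (⟨x, cyclicGen m ^ q⟩ : CyclicWreath S m) ∈ funStab f then
        ∏ j, φ j (cycleProd q x j) else 0) * (Nat.card R : ℚ) ^ q =
    (Nat.card R : ℚ) ^ m * ∏ j : Fin q, ∑ s : S,
      if s ∈ coordStabilizer f (cyclicGen m ^ (j : ℕ)) then φ j s else 0 := by
  let F : Finset (Multiplicative (ZMod m) → S) :=
    Finset.univ.filter fun x => (⟨x, cyclicGen m ^ q⟩ : CyclicWreath S m) ∈ funStab f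
  -- P acts on F through the first q coordinates and translates the cycle products, which themselves
  -- lie in the stabilizers. Summing over P and F in both orders gives the equidistribution.
  let P := ∀ j : Fin q, coordStabilizer f (cyclicGen m ^ (j : ℕ))
  let Φ (t : P) : ℚ := ∏ j, φ j (t j)
  have hF : (F.card : ℚ) = (Nat.card R : ℚ) ^ m := by
    have := card_mk_mem_funStab f (cyclicGen m ^ q)
    rw [card_multiplicative_zmod, Nat.card_eq_fintype_card, Fintype.card_subtype] at this
    exact_mod_cast this
  have hP : (Fintype.card P : ℚ) = (Nat.card R : ℚ) ^ q := by
    rw [← Nat.card_eq_fintype_card, Nat.card_pi,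
      Finset.prod_congr rfl fun j _ => card_coordStabilizer f _]
    simp
  have hfix : ∀ (t : P) (c : Multiplicative (ZMod m)),
      headFun (fun j => (t j : S)) c • f c = f c := by
    intro t c
    obtain ⟨k, hk, rfl⟩ := exists_cyclicGen_pow m c
    rw [headFun_pow _ hk]
    split_ifs with h
    · exact (t ⟨k, h⟩).2
    · exact one_smul _ _
  have hact : ∀ (t : P) (x : Multiplicative (ZMod m) → S),
      x ∈ F ↔ headFun (fun j => (t j : S)) * x ∈ F := by
    intro t x
    simp only [F, Finset.mem_filter, Finset.mem_univ, true_and, mem_funStab]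
    refine forall_congr' fun c => ?_
    rw [Pi.mul_apply, mul_smul]
    conv_rhs => rw [← hfix t c]
    rw [smul_left_cancel_iff]
  have hsum : ∀ t : P, ∑ x ∈ F, ∏ j, φ j (t j * cycleProd q x j) =
      ∑ x ∈ F, ∏ j, φ j (cycleProd q x j) := by
    intro t
    refine Finset.sum_equiv (Equiv.mulLeft (headFun fun j => (t j : S))) (hact t) fun x _ => ?_
    refine Finset.prod_congr rfl fun j _ => ?_
    rw [Equiv.coe_mulLeft, cycleProd_headFun_mul hq]
  have hsum' : ∀ x ∈ F, ∑ t : P, ∏ j, φ j (t j * cycleProd q x j) = ∑ t : P, Φ t := by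
    intro x hx
    have hx' := (Finset.mem_filter.1 hx).2
    exact Fintype.sum_equiv (Equiv.mulRight (fun j => ⟨_, cycleProd_mem_stabilizer hq hx' j⟩ : P))
      _ _ fun t => rfl
  have hprod : ∑ t : P, Φ t = ∏ j : Fin q, ∑ s : S,
      if s ∈ coordStabilizer f (cyclicGen m ^ (j : ℕ)) then φ j s else 0 := by
    have : ∀ j : Fin q, (∑ s : S,
        if s ∈ coordStabilizer f (cyclicGen m ^ (j : ℕ)) then φ j s else 0) =
        ∑ s : coordStabilizer f (cyclicGen m ^ (j : ℕ)), φ j s := by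
      intro j
      rw [← Finset.sum_filter]
      exact Finset.sum_subtype _ (by simp) _
    simp only [this, Φ]
    rw [Finset.prod_univ_sum]
    simp [P]
  rw [← Finset.sum_filter, ← hP, ← hF, ← hprod, mul_comm]
  calc (Fintype.card P : ℚ) * ∑ x ∈ F, ∏ j, φ j (cycleProd q x j)
      = ∑ t : P, ∑ x ∈ F, ∏ j, φ j (t j * cycleProd q x j) := by
        rw [Finset.sum_congr rfl fun t _ => hsum t, Finset.sum_const, Finset.card_univ,
          nsmul_eq_mul]
    _ = ∑ x ∈ F, ∑ t : P, ∏ j, φ j (t j * cycleProd q x j) := Finset.sum_comm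
    _ = F.card * ∑ t : P, Φ t := by
        rw [Finset.sum_congr rfl hsum', Finset.sum_const, nsmul_eq_mul]

open Classical in
theorem sum_cycleProd_mul_univ {S : Type*} [Group S] [Fintype S] {m q : ℕ} [NeZero m] (hq : q ∣ m)
    (φ : Fin q → S → ℚ) :
    (∑ x : Multiplicative (ZMod m) → S, ∏ j, φ j (cycleProd q x j)) * (Nat.card S : ℚ) ^ q =
    (Nat.card S : ℚ) ^ m * ∏ j : Fin q, ∑ s : S, φ j s := by
  have h := sum_cycleProd_mul (R := ⊤) hq (fun _ : Multiplicative (ZMod m) => ((1 : S) : S ⧸ _)) φ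
  have h0 : Subsingleton (S ⧸ (⊤ : Subgroup S)) := QuotientGroup.subsingleton_quotient_top
  have h1 : ∀ x : Multiplicative (ZMod m) → S, (⟨x, cyclicGen m ^ q⟩ : CyclicWreath S m) ∈
      funStab (fun _ : Multiplicative (ZMod m) => ((1 : S) : S ⧸ (⊤ : Subgroup S))) :=
    fun x c => Subsingleton.elim _ _
  have h2 : ∀ (s : S) (c : Multiplicative (ZMod m)), s ∈ coordStabilizer
      (fun _ : Multiplicative (ZMod m) => ((1 : S) : S ⧸ (⊤ : Subgroup S))) c :=
    fun s c => Subsingleton.elim _ _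
  simpa only [h1, h2, if_true, Subgroup.card_top] using h

/-! ### Numerical estimates. -/

section Numeric

/-- The least prime divisor is at least 2 and every other one at least 3. -/
theorem two_mul_three_pow_le {m : ℕ} (hm : 2 ≤ m) : 2 * 3 ^ (numPrimeDivisors m - 1) ≤ m := by
  have hmem : m.minFac ∈ m.primeFactors :=
    Nat.mem_primeFactors.2 ⟨Nat.minFac_prime (by omega), Nat.minFac_dvd m, by omega⟩
  have h1 : ∏ p ∈ m.primeFactors, p ≤ m :=
    Nat.le_of_dvd (by omega) (Nat.prod_primeFactors_dvd m)
  rw [← Finset.mul_prod_erase _ _ hmem] at h1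
  refine le_trans (Nat.mul_le_mul (Nat.minFac_prime (by omega)).two_le ?_) h1
  rw [numPrimeDivisors, ← Finset.card_erase_of_mem hmem, ← Finset.prod_const]
  refine Finset.prod_le_prod' fun p hp => ?_
  obtain ⟨hne, hp⟩ := Finset.mem_erase.1 hp
  have h2 := Nat.minFac_le_of_dvd (Nat.prime_of_mem_primeFactors hp).two_le
    (Nat.dvd_of_mem_primeFactors hp)
  have h3 := (Nat.minFac_prime (n := m) (by omega)).two_le
  omega

/-- Controls the diagonal error after b - d coordinates are frozen: m grows exponentially in b,
which leaves ample room in the exponent. -/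
theorem mul_pow_le_two_mul_pow {m s b d : ℕ} (hm : 2 ≤ m) (hs : 2 ≤ s) (hd : 1 ≤ d) (hdb : d < b)
    (hb : b ≤ numPrimeDivisors m) :
    d * b * s ^ (m / m.minFac + (b - d)) ≤ 2 * s ^ (m - 2) := by
  have h1 : 2 * 3 ^ (b - 1) ≤ m :=
    (Nat.mul_le_mul_left _ (Nat.pow_le_pow_right (by norm_num) (by omega))).trans
      (two_mul_three_pow_le hm)
  have h2 : m / m.minFac ≤ m / 2 :=
    Nat.div_le_div_left (Nat.minFac_prime (by omega)).two_le (by norm_num)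
  obtain rfl | hb3 : b = 2 ∨ 3 ≤ b := by omega
  · obtain rfl : d = 1 := by omega
    norm_num at h1 ⊢
    exact Nat.pow_le_pow_right (by omega) (by omega)
  -- With b = k + 3, `h4` absorbs the factor d b into 2 s^b, and `h3` provides the exponents through
  -- 2b + 1 ≤ 3^(b-1) ≤ m/2.
  · have h3 : ∀ k : ℕ, 2 * (k + 3) + 1 ≤ 3 ^ (k + 2) := by
      intro k
      induction k with
      | zero => norm_num
      | succ k ih => rw [show k + 1 + 2 = (k + 2) + 1 by ring, pow_succ]; omega
    have h4 : ∀ k : ℕ, (k + 3) * (k + 3) ≤ 2 * 2 ^ (k + 3) := by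
      intro k
      induction k with
      | zero => norm_num
      | succ k ih => rw [show k + 1 + 3 = (k + 3) + 1 by ring, pow_succ]; nlinarith
    obtain ⟨k, rfl⟩ := Nat.exists_eq_add_of_le' hb3
    have h5 := h3 k
    rw [show k + 3 - 1 = k + 2 by omega] at h1
    calc d * (k + 3) * s ^ (m / m.minFac + (k + 3 - d))
        ≤ (k + 3) * (k + 3) * s ^ (m / m.minFac + (k + 3 - d)) :=
          Nat.mul_le_mul_right _ (Nat.mul_le_mul_right _ hdb.le)
      _ ≤ 2 * s ^ (k + 3) * s ^ (m / m.minFac + (k + 3 - d)) :=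
          Nat.mul_le_mul_right _ ((h4 k).trans
            (Nat.mul_le_mul_left _ (Nat.pow_le_pow_left hs _)))
      _ = 2 * s ^ (k + 3 + (m / m.minFac + (k + 3 - d))) := by rw [mul_assoc, ← pow_add]
      _ ≤ 2 * s ^ (m - 2) :=
          Nat.mul_le_mul_left _ (Nat.pow_le_pow_right (by omega) (by omega))

end Numeric

/-! ### The weight function attached to an admissible pair. -/

theorem Subgroup.index_pow_eq_div {S : Type*} [Group S] [Finite S] (M : Subgroup S) (k : ℕ) :
    ((M.index : ℚ)) ^ k = (Nat.card S : ℚ) ^ k / (Nat.card M : ℚ) ^ k := by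
  have h : (Nat.card M : ℚ) ≠ 0 := by exact_mod_cast Nat.card_pos.ne'
  rw [← M.card_mul_index, Nat.cast_mul, mul_pow, mul_div_cancel_left₀ _ (pow_ne_zero _ h)]

namespace AdmissiblePair

variable {S : Type*} [Group S] [Finite S] {m : ℕ} {A : Set S} {𝓜 : Finset (Subgroup S)}

theorem ncard_pos (h : AdmissiblePair m A 𝓜) {M : Subgroup S} (hM : M ∈ 𝓜) :
    0 < (A ∩ (M : Set S)).ncard :=
  (Set.ncard_pos (Set.toFinite _)).2 (h.meets M hM)

/-- M is not normal: by simplicity it would be ⊤ or ⊥, and a maximal ⊥ would leave 𝓜 with a single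
conjugacy class. So 𝓜 contains a second conjugate, of the same index. -/
theorem two_mul_index_pow_le [IsSimpleGroup S] (h : AdmissiblePair m A 𝓜) {M : Subgroup S}
    (hM : M ∈ 𝓜) : 2 * M.index ^ (m - 1) ≤ ∑ M ∈ 𝓜, M.index ^ (m - 1) := by
  classical
  obtain ⟨s, hs⟩ : ∃ s : S, MulAut.conj s • M ≠ M := by
    by_contra! hcon
    have hn : M.Normal := by
      refine ⟨fun n hn g => ?_⟩
      rw [← hcon g]
      exact Subgroup.smul_mem_pointwise_smul n (MulAut.conj g) M hn
    rcases hn.eq_bot_or_eq_top with rfl | rfl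
    · obtain ⟨M₁, h₁, M₂, h₂, hne⟩ := h.exists_nonconj
      have hbot : ∀ N ∈ 𝓜, N = ⊥ := by
        intro N hN
        rcases (bot_le : ⊥ ≤ N).eq_or_lt with h1 | h1
        · exact h1.symm
        · exact absurd ((h.maximal ⊥ hM).2 N h1) (h.maximal N hN).1
      exact hne ⟨1, by rw [hbot _ h₁, hbot _ h₂]; simp⟩
    · exact (h.maximal ⊤ hM).1 rfl
  have hidx : (MulAut.conj s • M).index = M.index := by
    have h1 : Nat.card (MulAut.conj s • M : Subgroup S) = Nat.card M :=
      (Nat.card_congr (Subgroup.equivSMul (MulAut.conj s) M).toEquiv).symm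
    have h2 := (MulAut.conj s • M).card_mul_index
    rw [h1, ← M.card_mul_index] at h2
    exact Nat.eq_of_mul_eq_mul_left Nat.card_pos h2
  have hsub : ({MulAut.conj s • M, M} : Finset (Subgroup S)) ⊆ 𝓜 := by
    intro N hN
    rw [Finset.mem_insert, Finset.mem_singleton] at hN
    rcases hN with rfl | rfl
    · exact h.conj_mem M hM s
    · exact hM
  refine le_trans (le_of_eq ?_) (Finset.sum_le_sum_of_subset hsub)
  rw [Finset.sum_pair hs, hidx, two_mul]

open Classical in
/-- There is a weight on `A` for which the total weight is determined by the indices of the members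
of `𝓜`, no proper subgroup is too heavy, and no element is heavier than the elements of the
least popular member `M₀` of `𝓜`. -/
theorem exists_weight [Fintype S] (h : AdmissiblePair m A 𝓜) :
    ∃ ω : S → ℚ, ∃ M₀ ∈ 𝓜, (∀ s, 0 ≤ ω s) ∧
      (∀ s, ω s * ((A ∩ (M₀ : Set S)).ncard * (Nat.card M₀ : ℚ) ^ (m - 1)) ≤ 1) ∧
      (∑ s, ω s) * (Nat.card S : ℚ) ^ (m - 1) = (∑ M ∈ 𝓜, M.index ^ (m - 1) : ℕ) ∧
      ∀ R : Subgroup S, R ≠ ⊤ →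
        (Nat.card R : ℚ) ^ (m - 1) * ∑ s, (if s ∈ R then ω s else 0) ≤ 1 := by
  let v (M : Subgroup S) : ℕ := (A ∩ (M : Set S)).ncard * Nat.card M ^ (m - 1)
  have hv : ∀ M ∈ 𝓜, (0 : ℚ) < v M := fun M hM => by
    exact_mod_cast Nat.mul_pos (h.ncard_pos hM) (pow_pos Nat.card_pos _)
  obtain ⟨M₀, hM₀, hmin⟩ := Finset.exists_min_image 𝓜 v h.nonempty_family
  -- By disjointness the sum has a single nonzero term. The value 1 / v M is chosen so that each M
  -- in 𝓜 attains equality in the last bound.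
  let ω (s : S) : ℚ := if s ∈ A then ∑ M ∈ 𝓜, if s ∈ M then (1 / v M : ℚ) else 0 else 0
  have hω : ∀ s ∈ A, ∀ M ∈ 𝓜, s ∈ M → ω s = 1 / v M := by
    intro s hs M hM hsM
    simp only [ω, if_pos hs]
    rw [Finset.sum_eq_single_of_mem M hM, if_pos hsM]
    intro N hN hne
    rw [if_neg]
    intro hsN
    have : s ∈ A ∩ (N : Set S) ∩ (M : Set S) := ⟨⟨hs, hsN⟩, hsM⟩
    rw [h.disjoint N hN M hM hne] at this
    exact this
  have hω0 : ∀ s ∉ A, ω s = 0 := fun s hs => by simp only [ω, if_neg hs]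
  have hmem : ∀ s ∈ A, ∃ M ∈ 𝓜, s ∈ M := by
    intro s hs
    simpa using h.subset_iUnion hs
  have hle : ∀ s, ω s ≤ if s ∈ A then (1 / v M₀ : ℚ) else 0 := by
    intro s
    split_ifs with hs
    · obtain ⟨M, hM, hsM⟩ := hmem s hs
      rw [hω s hs M hM hsM]
      exact one_div_le_one_div_of_le (hv _ hM₀) (by exact_mod_cast hmin M hM)
    · exact (hω0 s hs).le
  have hcount : ∀ (R : Subgroup S) (a : ℚ),
      ∑ s, (if s ∈ R then (if s ∈ A then a else 0) else 0) = (A ∩ (R : Set S)).ncard * a := by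
    intro R a
    rw [Set.ncard_eq_toFinset_card', ← nsmul_eq_mul, ← Finset.sum_const, ← Finset.sum_filter,
      ← Finset.sum_filter, Finset.filter_filter]
    refine Finset.sum_congr ?_ fun _ _ => rfl
    ext s
    simp [and_comm]
  refine ⟨ω, M₀, hM₀, ?_, ?_, ?_, ?_⟩
  · intro s
    simp only [ω]
    split_ifs
    · refine Finset.sum_nonneg fun M _ => ?_
      split_ifs <;> positivity
    · exact le_rfl
  · intro s
    have h1 : ω s ≤ 1 / v M₀ := by
      refine (hle s).trans ?_
      split_ifs
      · exact le_rfl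
      · exact (one_div_pos.2 (hv _ hM₀)).le
    have h2 := mul_le_mul_of_nonneg_right h1 (hv _ hM₀).le
    rw [one_div_mul_cancel (hv _ hM₀).ne'] at h2
    simpa [v] using h2
  · have h1 : ∑ s, ω s = ∑ M ∈ 𝓜, (1 / (Nat.card M : ℚ) ^ (m - 1)) := by
      have h2 : ∀ s, ω s =
          ∑ M ∈ 𝓜, if s ∈ M then (if s ∈ A then (1 / v M : ℚ) else 0) else 0 := by
        intro s
        simp only [ω]
        split_ifs with hs
        · rfl
        · simp
      simp only [h2]
      rw [Finset.sum_comm]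
      refine Finset.sum_congr rfl fun M hM => ?_
      rw [hcount]
      have h3 : ((A ∩ (M : Set S)).ncard : ℚ) ≠ 0 := by exact_mod_cast (h.ncard_pos hM).ne'
      have h4 : (Nat.card M : ℚ) ≠ 0 := by exact_mod_cast Nat.card_pos.ne'
      simp only [v, Nat.cast_mul, Nat.cast_pow]
      field_simp
    rw [h1, Finset.sum_mul, Nat.cast_sum]
    refine Finset.sum_congr rfl fun M _ => ?_
    rw [Nat.cast_pow, Subgroup.index_pow_eq_div]
    ring
  · intro R hR
    by_cases hRM : R ∈ 𝓜
    · have h1 : ∀ s, (if s ∈ R then ω s else 0) =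
          if s ∈ R then (if s ∈ A then (1 / v R : ℚ) else 0) else 0 := by
        intro s
        split_ifs with h1 h2
        · exact hω s h2 R hRM h1
        · exact hω0 s h2
        · rfl
      simp only [h1]
      rw [hcount]
      have h2 := (hv R hRM).ne'
      apply le_of_eq
      field_simp
      simp only [v, Nat.cast_mul, Nat.cast_pow]
      ring
    · have h1 : ∑ s, (if s ∈ R then ω s else 0) ≤ (A ∩ (R : Set S)).ncard * (1 / v M₀ : ℚ) := by
        rw [← hcount]
        refine Finset.sum_le_sum fun s _ => ?_
        split_ifs with h1
        · have := hle s
          rwa [if_pos (by assumption)] at this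
        · have := hle s
          rwa [if_neg (by assumption)] at this
        · exact le_rfl
      refine (mul_le_mul_of_nonneg_left h1 (by positivity)).trans ?_
      -- Outside 𝓜 the weight of R is bounded by its number of points in A times the largest value 1
      -- / v M₀, so only comparison with M₀ is needed.
      have h2 : ((A ∩ (R : Set S)).ncard * Nat.card R ^ (m - 1) : ℚ) ≤ v M₀ := by
        exact_mod_cast h.notMem_le_mem R hR hRM M₀ hM₀
      rw [mul_one_div, mul_div_assoc', div_le_one (hv _ hM₀), mul_comm]
      exact h2

end AdmissiblePair

/-! ### The lower bound: counting in one coset of the base group. -/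

theorem RegularWreathProduct.card_mk_mem_le {D Q : Type*} [Group D] [Finite D] [Group Q] [Finite Q]
    (K : Subgroup (D ≀ᵣ Q)) (δ : Q) :
    Nat.card {x : Q → D // (⟨x, δ⟩ : D ≀ᵣ Q) ∈ K} ≤ Nat.card (basePart K) := by
  rcases isEmpty_or_nonempty {x : Q → D // (⟨x, δ⟩ : D ≀ᵣ Q) ∈ K} with h | ⟨⟨y, hy⟩⟩
  · simp
  · refine Nat.card_le_card_of_injective (fun x => ⟨x.1 * y⁻¹, ?_⟩) ?_
    · have h1 := K.mul_mem x.2 (K.inv_mem hy)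
      rw [mem_basePart]
      convert h1 using 1
      ext <;> simp
    · intro x x' hx
      have := congrArg Subtype.val hx
      exact Subtype.ext (mul_right_cancel this)

open Classical in
/-- The elements of a coset of the base group, weighted by one of their cycle products and
restricted by the others, are covered by point stabilizers and by subgroups meeting the base group
in few elements. -/
theorem weighted_box_cover {S : Type*} [Group S] [Fintype S] {m n : ℕ} [NeZero m]
    (hn : n + 1 ∣ m) {I : Type*} [Fintype I] (R : I → Subgroup S)
    (f : ∀ k, Multiplicative (ZMod m) → S ⧸ R k) (𝓓 : Finset (Subgroup (CyclicWreath S m)))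
    {B T : ℕ} {v : ℚ} (hv : 0 < v) (hB : ∀ K ∈ 𝓓, Nat.card (basePart K) ≤ B)
    (hcov : ∀ x, (∃ k, (⟨x, cyclicGen m ^ (n + 1)⟩ : CyclicWreath S m) ∈ funStab (f k)) ∨
      ∃ K ∈ 𝓓, (⟨x, cyclicGen m ^ (n + 1)⟩ : CyclicWreath S m) ∈ K)
    {ω : S → ℚ} (hω0 : ∀ s, 0 ≤ ω s) (hωv : ∀ s, ω s * v ≤ 1)
    (hωT : (∑ s, ω s) * (Nat.card S : ℚ) ^ (m - 1) = T)
    (hωR : ∀ k c, (Nat.card (R k) : ℚ) ^ (m - 1) *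
      ∑ s, (if s ∈ coordStabilizer (f k) c then ω s else 0) ≤ 1)
    (Y : Fin n → Finset S) :
    (T : ℚ) * ∏ j, ((Y j).card / Nat.card S : ℚ) ≤
      ∑ k, ∏ j, (((Y j).filter
        (· ∈ coordStabilizer (f k) (cyclicGen m ^ ((j.succ : Fin (n + 1)) : ℕ)))).card /
        Nat.card (coordStabilizer (f k) (cyclicGen m ^ ((j.succ : Fin (n + 1)) : ℕ))) : ℚ) +
      𝓓.card * B / v := by
  -- Cycle product 0 carries the weight; the other n are tested against the sets `Y j`.
  let φ : Fin (n + 1) → S → ℚ := Fin.cons ω fun j s => if s ∈ Y j then 1 else 0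
  let Φ (x : Multiplicative (ZMod m) → S) : ℚ := ∏ j, φ j (cycleProd (n + 1) x j)
  have hφ0 : ∀ j s, 0 ≤ φ j s := by
    intro j s
    refine Fin.cases ?_ (fun j => ?_) j
    · exact hω0 s
    · simp only [φ, Fin.cons_succ]
      split_ifs <;> norm_num
  have hΦ0 : ∀ x, 0 ≤ Φ x := fun x => Finset.prod_nonneg fun j _ => hφ0 j _
  have hΦv : ∀ x, Φ x ≤ 1 / v := by
    intro x
    simp only [Φ]
    rw [Fin.prod_univ_succ]
    have h1 : φ 0 (cycleProd (n + 1) x 0) ≤ 1 / v := (le_div_iff₀ hv).2 (hωv _)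
    refine (mul_le_of_le_one_right (hφ0 _ _) (Finset.prod_le_one (fun j _ => hφ0 _ _) ?_)).trans h1
    intro j _
    simp only [φ, Fin.cons_succ]
    split_ifs <;> norm_num
  have hm : m = (m - 1) + 1 := (Nat.sub_add_cancel (NeZero.one_le)).symm
  have hs : (Nat.card S : ℚ) ≠ 0 := by exact_mod_cast Nat.card_pos.ne'
  have htot : ∑ x, Φ x = (T : ℚ) * ∏ j, ((Y j).card / Nat.card S : ℚ) := by
    have h1 := sum_cycleProd_mul_univ hn φ
    rw [Fin.prod_univ_succ] at h1
    have h2 : ∀ j : Fin n, ∑ s, φ j.succ s = (Y j).card := by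
      intro j
      simp [φ]
    have h3 : ∑ s, φ 0 s = ∑ s, ω s := rfl
    rw [Finset.prod_congr rfl fun j _ => h2 j, h3] at h1
    have h4 : (Nat.card S : ℚ) ^ m * ((∑ s, ω s) * ∏ j, ((Y j).card : ℚ)) =
        T * Nat.card S * ∏ j, ((Y j).card : ℚ) := by
      rw [← hωT, hm, pow_succ, Nat.add_sub_cancel]
      ring
    rw [h4] at h1
    rw [Finset.prod_div_distrib, Finset.prod_const, Finset.card_univ, Fintype.card_fin,
      mul_div_assoc', eq_div_iff (pow_ne_zero _ hs)]
    rw [pow_succ, ← mul_assoc] at h1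
    apply mul_right_cancel₀ hs
    rw [h1]
    ring
  have hprod : ∀ k, (∑ x, if (⟨x, cyclicGen m ^ (n + 1)⟩ : CyclicWreath S m) ∈ funStab (f k) then
      Φ x else 0) ≤ ∏ j, (((Y j).filter
        (· ∈ coordStabilizer (f k) (cyclicGen m ^ ((j.succ : Fin (n + 1)) : ℕ)))).card /
        Nat.card (coordStabilizer (f k) (cyclicGen m ^ ((j.succ : Fin (n + 1)) : ℕ))) :
          ℚ) := by
    intro k
    have h1 := sum_cycleProd_mul hn (f k) φ
    rw [Fin.prod_univ_succ] at h1
    have h2 : ∀ j : Fin n, (∑ s, if s ∈ coordStabilizer (f k)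
        (cyclicGen m ^ ((j.succ : Fin (n + 1)) : ℕ)) then φ j.succ s else 0) =
        ((Y j).filter (· ∈ coordStabilizer (f k)
          (cyclicGen m ^ ((j.succ : Fin (n + 1)) : ℕ)))).card := by
      intro j
      simp only [φ, Fin.cons_succ]
      rw [← Finset.sum_filter, ← Finset.sum_filter, Finset.sum_const, nsmul_eq_mul, mul_one,
        Finset.filter_filter]
      congr 2
      ext s
      simp only [Finset.mem_filter, Finset.mem_univ, true_and]
      exact and_comm
    rw [Finset.prod_congr rfl fun j _ => h2 j] at h1
    have hr : (0 : ℚ) < Nat.card (R k) := by exact_mod_cast Nat.card_pos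
    simp only [card_coordStabilizer]
    rw [Finset.prod_div_distrib, Finset.prod_const, Finset.card_univ, Fintype.card_fin,
      le_div_iff₀ (pow_pos hr _)]
    refine le_of_mul_le_mul_right ?_ hr
    rw [mul_assoc, ← pow_succ, h1]
    have h3 := hωR k (cyclicGen m ^ ((0 : Fin (n + 1)) : ℕ))
    have h4 : (Nat.card (R k) : ℚ) ^ m = Nat.card (R k) ^ (m - 1) * Nat.card (R k) := by
      rw [← pow_succ, ← hm]
    rw [h4]
    have h5 : (0 : ℚ) ≤ (∏ j : Fin n, (((Y j).filter (· ∈ coordStabilizer (f k)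
          (cyclicGen m ^ ((j.succ : Fin (n + 1)) : ℕ)))).card : ℚ)) * Nat.card (R k) := by
      exact mul_nonneg (Finset.prod_nonneg fun _ _ => Nat.cast_nonneg _) hr.le
    have h6 := mul_le_mul_of_nonneg_right h3 h5
    rw [one_mul] at h6
    refine le_trans (le_of_eq ?_) h6
    have h7 : φ 0 = ω := rfl
    rw [h7]
    ring
  have hsmall : ∀ K ∈ 𝓓, (∑ x, if (⟨x, cyclicGen m ^ (n + 1)⟩ : CyclicWreath S m) ∈ K then
      Φ x else 0) ≤ B / v := by
    intro K hK
    have h1 : (∑ x, if (⟨x, cyclicGen m ^ (n + 1)⟩ : CyclicWreath S m) ∈ K then Φ x else 0) ≤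
        ∑ x, if (⟨x, cyclicGen m ^ (n + 1)⟩ : CyclicWreath S m) ∈ K then 1 / v else 0 := by
      refine Finset.sum_le_sum fun x _ => ?_
      split_ifs
      · exact hΦv x
      · exact le_rfl
    refine h1.trans ?_
    rw [← Finset.sum_filter, Finset.sum_const, nsmul_eq_mul, mul_one_div,
      ← Fintype.card_subtype, ← Nat.card_eq_fintype_card]
    refine div_le_div_of_nonneg_right ?_ hv.le
    exact_mod_cast (card_mk_mem_le K _).trans (hB K hK)
  have hpt : ∀ x, Φ x ≤
      (∑ k, if (⟨x, cyclicGen m ^ (n + 1)⟩ : CyclicWreath S m) ∈ funStab (f k) then Φ x else 0) +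
      ∑ K ∈ 𝓓, if (⟨x, cyclicGen m ^ (n + 1)⟩ : CyclicWreath S m) ∈ K then Φ x else 0 := by
    intro x
    have hnn : ∀ p : Prop, 0 ≤ if p then Φ x else 0 := by
      intro p
      split_ifs
      · exact hΦ0 x
      · exact le_rfl
    rcases hcov x with ⟨k, hk⟩ | ⟨K, hK, hxK⟩
    · refine le_add_of_le_of_nonneg ?_ (Finset.sum_nonneg fun _ _ => hnn _)
      refine le_trans (le_of_eq ?_)
        (Finset.single_le_sum (fun _ _ => hnn _) (Finset.mem_univ k))
      rw [if_pos hk]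
    · refine le_add_of_nonneg_of_le (Finset.sum_nonneg fun _ _ => hnn _) ?_
      refine le_trans (le_of_eq ?_) (Finset.single_le_sum (fun _ _ => hnn _) hK)
      rw [if_pos hxK]
  rw [← htot]
  refine (Finset.sum_le_sum fun x _ => hpt x).trans ?_
  rw [Finset.sum_add_distrib, Finset.sum_comm]
  refine add_le_add (Finset.sum_le_sum fun k _ => hprod k) ?_
  rw [Finset.sum_comm]
  refine (Finset.sum_le_sum hsmall).trans (le_of_eq ?_)
  rw [Finset.sum_const, nsmul_eq_mul, mul_div_assoc]

theorem overBase_injOn {S : Type*} [Group S] {m : ℕ} :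
    Set.InjOn (overBase S m) (m.primeFactors : Set ℕ) := by
  intro p hp q hq hpq
  have h1 : (⟨1, cyclicGen m ^ p⟩ : CyclicWreath S m) ∈ overBase S m p := Subgroup.mem_zpowers _
  rw [hpq, mem_overBase, cyclicGen_pow_mem_zpowers_iff (Nat.dvd_of_mem_primeFactors hq)] at h1
  exact ((Nat.prime_dvd_prime_iff_eq (Nat.prime_of_mem_primeFactors hq)
    (Nat.prime_of_mem_primeFactors hp)).1 h1).symm

theorem basePart_overBase {S : Type*} [Group S] (m p : ℕ) : basePart (overBase S m p) = ⊤ := by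
  rw [Subgroup.eq_top_iff']
  intro x
  rw [mem_basePart, mem_overBase]
  exact one_mem _

theorem index_le_div_minFac {m : ℕ} [NeZero m] {T : Subgroup (Multiplicative (ZMod m))}
    (hT : T ≠ ⊥) : T.index ≤ m / m.minFac := by
  have h1 := T.card_mul_index
  rw [card_multiplicative_zmod] at h1
  have h2 : 2 ≤ Nat.card T := by
    have h3 : Nat.card T ≠ 1 := fun h => hT (Subgroup.card_eq_one.1 h)
    have h4 := Nat.card_pos (α := T)
    omega
  rw [Nat.le_div_iff_mul_le (Nat.minFac_pos m), mul_comm]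
  calc m.minFac * T.index ≤ Nat.card T * T.index :=
        Nat.mul_le_mul_right _ (Nat.minFac_le_of_dvd h2 ⟨_, h1.symm⟩)
    _ = m := h1

/-- Some divisor of `m` exceeds the number of the given prime divisors of `m`, and is not divisible
by any other prime divisor of `m`. -/
theorem exists_succ_dvd {m : ℕ} {P : Finset ℕ} (hP : P ⊆ m.primeFactors) :
    ∃ n, n + 1 ∣ m ∧ P.card ≤ n ∧ ∀ p ∈ m.primeFactors, p ∉ P → ¬ p ∣ n + 1 := by
  rcases P.eq_empty_or_nonempty with rfl | hne
  · refine ⟨0, one_dvd _, le_rfl, fun p hp _ h => ?_⟩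
    exact (Nat.prime_of_mem_primeFactors hp).one_lt.ne' (Nat.dvd_one.1 h)
  · have hmem := P.max'_mem hne
    have hprime := Nat.prime_of_mem_primeFactors (hP hmem)
    -- Here n + 1 is the largest prime in P. It exceeds |P| because P consists of integers between 2
    -- and n + 1.
    refine ⟨P.max' hne - 1, ?_⟩
    rw [Nat.sub_add_cancel hprime.one_le]
    refine ⟨Nat.dvd_of_mem_primeFactors (hP hmem), ?_, fun p hp hpP h => ?_⟩
    · have h1 : P ⊆ Finset.Icc 2 (P.max' hne) := fun p hp =>
        Finset.mem_Icc.2 ⟨(Nat.prime_of_mem_primeFactors (hP hp)).two_le, P.le_max' p hp⟩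
      have h2 := Finset.card_le_card h1
      rw [Nat.card_Icc] at h2
      omega
    · rw [Nat.prime_dvd_prime_iff_eq (Nat.prime_of_mem_primeFactors hp) hprime] at h
      exact hpP (h ▸ hmem)

/-- A family of maximal subgroups of `S ≀ C_m` covering the group is large. -/
theorem AdmissiblePair.le_card_of_isCoatom {S : Type*} [Group S] [Finite S] [IsSimpleGroup S]
    (hS : ∃ a b : S, a * b ≠ b * a) {m : ℕ} {A : Set S} {𝓜 : Finset (Subgroup S)}
    (h : AdmissiblePair m A 𝓜) (𝓒 : Finset (Subgroup (CyclicWreath S m)))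
    (hmax : ∀ K ∈ 𝓒, IsCoatom K) (hcov : ∀ z, ∃ K ∈ 𝓒, z ∈ K) :
    numPrimeDivisors m + ∑ M ∈ 𝓜, M.index ^ (m - 1) ≤ 𝓒.card := by
  classical
  have := Fintype.ofFinite S
  have hm2 := h.two_le
  have : NeZero m := ⟨by omega⟩
  have : Fact (1 < m) := ⟨by omega⟩
  have : Nontrivial (Multiplicative (ZMod m)) := inferInstanceAs (Nontrivial (ZMod m))
  let IsProd (K : Subgroup (CyclicWreath S m)) : Prop :=
    ∃ R : Subgroup S, R ≠ ⊤ ∧ ∃ f : Multiplicative (ZMod m) → S ⧸ R, K ≤ funStab f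
  let 𝓑 := 𝓒.filter fun K => basePart K = ⊤
  let 𝓟 := 𝓒.filter fun K => basePart K ≠ ⊤ ∧ IsProd K
  let 𝓓 := 𝓒.filter fun K => basePart K ≠ ⊤ ∧ ¬ IsProd K
  let P := m.primeFactors.filter fun p => overBase S m p ∉ 𝓒
  have hcard : 𝓒.card = 𝓑.card + (𝓟.card + 𝓓.card) := by
    rw [← Finset.card_filter_add_card_filter_not (s := 𝓒) fun K => basePart K = ⊤]
    congr 1
    rw [← Finset.card_filter_add_card_filter_not
      (s := 𝓒.filter fun K => ¬ basePart K = ⊤) IsProd, Finset.filter_filter,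
      Finset.filter_filter]
  have hα : numPrimeDivisors m ≤ 𝓑.card + P.card := by
    have h1 : (m.primeFactors.filter fun p => overBase S m p ∈ 𝓒).card ≤ 𝓑.card := by
      refine Finset.card_le_card_of_injOn (overBase S m) ?_ ?_
      · intro p hp
        have hp' := (Finset.mem_filter.1 (Finset.mem_coe.1 hp)).2
        exact Finset.mem_coe.2 (Finset.mem_filter.2 ⟨hp', basePart_overBase m p⟩)
      · intro p hp q hq
        exact overBase_injOn (Finset.mem_filter.1 (Finset.mem_coe.1 hp)).1
          (Finset.mem_filter.1 (Finset.mem_coe.1 hq)).1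
    have h2 := Finset.card_filter_add_card_filter_not (s := m.primeFactors)
      fun p => overBase S m p ∈ 𝓒
    rw [numPrimeDivisors, ← h2]
    exact Nat.add_le_add_right h1 _
  -- The coset over the (n + 1)-st power of the generator misses every `overBase` in the cover; one
  -- cycle product takes the weight, and n ≥ |P| remain to be restricted.
  obtain ⟨n, hnm, hPn, hdvd⟩ := exists_succ_dvd (Finset.filter_subset _ _ : P ⊆ m.primeFactors)
  obtain ⟨ω, M₀, hM₀, hω0, hωv, hωT, hωR⟩ := h.exists_weight
  have hIsProd : ∀ K : 𝓟, IsProd K.1 := fun K => (Finset.mem_filter.1 K.2).2.2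
  choose R hR f hf using hIsProd
  have hstab : ∀ K c, coordStabilizer (f K) c ≠ ⊤ := by
    intro K c hc
    have h1 := card_coordStabilizer (f K) c
    rw [hc, Subgroup.card_top] at h1
    exact hR K ((R K).eq_top_of_card_eq h1.symm)
  let B := Nat.card S ^ (m / m.minFac)
  let v : ℕ := (A ∩ (M₀ : Set S)).ncard * Nat.card M₀ ^ (m - 1)
  let T := ∑ M ∈ 𝓜, M.index ^ (m - 1)
  have hvpos : 0 < v := Nat.mul_pos (h.ncard_pos hM₀) (pow_pos Nat.card_pos _)
  have hv : (0 : ℚ) < v := by exact_mod_cast hvpos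
  have hB : ∀ K ∈ 𝓓, Nat.card (basePart K) ≤ B := by
    intro K hK
    obtain ⟨hKC, hKt, hKP⟩ := Finset.mem_filter.1 hK
    rcases le_funStab_or_card_basePart_le hS
      (fun c => exists_mem_right_eq (hmax K hKC) hKt c) hKt with h1 | ⟨T, hT, h1⟩
    · exact absurd h1 hKP
    · exact h1.trans (Nat.pow_le_pow_right Nat.card_pos (index_le_div_minFac hT))
  have hcov' : ∀ x, (∃ K, (⟨x, cyclicGen m ^ (n + 1)⟩ : CyclicWreath S m) ∈ funStab (f K)) ∨
      ∃ K ∈ 𝓓, (⟨x, cyclicGen m ^ (n + 1)⟩ : CyclicWreath S m) ∈ K := by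
    intro x
    obtain ⟨K, hK, hxK⟩ := hcov ⟨x, cyclicGen m ^ (n + 1)⟩
    by_cases h1 : basePart K = ⊤
    · exfalso
      obtain ⟨p, hp, rfl⟩ := exists_overBase_of_basePart_eq_top (hmax K hK) h1
      rw [mem_overBase, cyclicGen_pow_mem_zpowers_iff (Nat.dvd_of_mem_primeFactors hp)] at hxK
      exact hdvd p hp (fun hpP => (Finset.mem_filter.1 hpP).2 hK) hxK
    · by_cases h2 : IsProd K
      · have hKP : K ∈ 𝓟 := Finset.mem_filter.2 ⟨hK, h1, h2⟩
        exact Or.inl ⟨⟨K, hKP⟩, hf ⟨K, hKP⟩ hxK⟩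
      · exact Or.inr ⟨K, Finset.mem_filter.2 ⟨hK, h1, h2⟩, hxK⟩
  have hcover := weighted_box_cover hnm R f 𝓓 (B := B) (T := T) hv hB hcov' hω0
    (fun s => by simpa [v] using hωv s) hωT (fun K c => by
      have h1 := hωR _ (hstab K c)
      rwa [card_coordStabilizer] at h1)
  have hs2 : 2 ≤ Nat.card S := Finite.one_lt_card
  have hT2 : 2 * M₀.index ^ (m - 1) ≤ T := h.two_mul_index_pow_le hM₀
  have hT1 : 1 ≤ T := by
    have : 0 < M₀.index ^ (m - 1) :=
      pow_pos (Nat.pos_of_ne_zero Subgroup.index_ne_zero_of_finite) _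
    omega
  have hE : (𝓓.card * B / v : ℚ) * (1 + numPrimeDivisors m) ≤ 𝓓.card := by
    have h1 : ((1 + numPrimeDivisors m) * B : ℚ) ≤ v := by
      exact_mod_cast h.diag_le_mem M₀ hM₀
    rw [div_mul_eq_mul_div, div_le_iff₀ hv, mul_assoc]
    refine mul_le_mul_of_nonneg_left ?_ (Nat.cast_nonneg _)
    linarith
  have hbα : P.card ≤ numPrimeDivisors m := Finset.card_filter_le _ _
  -- Two conjugates of M₀ give v T ≥ 2 |S|^(m-1). A small T therefore forces v to be large, and v is
  -- the denominator of the error.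
  have hsmall : 1 ≤ 𝓓.card → 𝓓.card < P.card → T < P.card * Nat.card S →
      (𝓓.card * B / v : ℚ) * (Nat.card S : ℚ) ^ (P.card - 𝓓.card) < 1 := by
    intro hd hdb hTb
    have h1 := mul_pow_le_two_mul_pow hm2 hs2 hd hdb hbα
    rw [pow_add] at h1
    have h2 : 2 * Nat.card S ^ (m - 1) ≤ v * T := by
      calc 2 * Nat.card S ^ (m - 1)
          = Nat.card M₀ ^ (m - 1) * (2 * M₀.index ^ (m - 1)) := by
            rw [← M₀.card_mul_index, mul_pow]; ring
        _ ≤ v * T := Nat.mul_le_mul (Nat.le_mul_of_pos_left _ (h.ncard_pos hM₀)) hT2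
    have h3 : v * T < v * (P.card * Nat.card S) := Nat.mul_lt_mul_of_pos_left hTb hvpos
    rw [show m - 1 = m - 2 + 1 by omega, pow_succ] at h2
    have h4 : 2 * Nat.card S ^ (m - 2) < v * P.card := by
      refine Nat.lt_of_mul_lt_mul_right (a := Nat.card S) ?_
      calc 2 * Nat.card S ^ (m - 2) * Nat.card S
          = 2 * (Nat.card S ^ (m - 2) * Nat.card S) := by ring
        _ < v * (P.card * Nat.card S) := h2.trans_lt h3
        _ = v * P.card * Nat.card S := by ring
    have h5 : 𝓓.card * B * Nat.card S ^ (P.card - 𝓓.card) < v := by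
      refine Nat.lt_of_mul_lt_mul_right (a := P.card) ?_
      calc 𝓓.card * B * Nat.card S ^ (P.card - 𝓓.card) * P.card
          = 𝓓.card * P.card * (B * Nat.card S ^ (P.card - 𝓓.card)) := by ring
        _ < v * P.card := h1.trans_lt h4
    rw [div_mul_eq_mul_div, div_lt_one hv]
    exact_mod_cast h5
  have hmain := add_le_card_add_of_box_cover
    (fun (K : 𝓟) (j : Fin n) =>
      coordStabilizer (f K) (cyclicGen m ^ ((j.succ : Fin (n + 1)) : ℕ)))
    (fun K j => hstab K _) hcover hs2 hT1 hE hbα hPn hsmall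
  rw [Fintype.card_coe] at hmain
  change numPrimeDivisors m + T ≤ _
  omega

theorem AdmissiblePair.le_coveringNumber {S : Type*} [Group S] [Finite S] [IsSimpleGroup S]
    (hS : ∃ a b : S, a * b ≠ b * a) {m : ℕ} {A : Set S} {𝓜 : Finset (Subgroup S)}
    (h : AdmissiblePair m A 𝓜) :
    ((numPrimeDivisors m + ∑ M ∈ 𝓜, M.index ^ (m - 1) : ℕ) : ℕ∞) ≤
      coveringNumber (CyclicWreath S m) := by
  classical
  have hm2 := h.two_le
  have : NeZero m := ⟨by omega⟩
  refine le_iInf₂ fun 𝓒 h𝓒 => ?_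
  have hex : ∀ H : Subgroup (CyclicWreath S m), ∃ K, H ≠ ⊤ → IsCoatom K ∧ H ≤ K := by
    intro H
    rcases eq_top_or_exists_le_coatom H with h1 | ⟨K, hK, hHK⟩
    · exact ⟨⊤, fun h2 => absurd h1 h2⟩
    · exact ⟨K, fun _ => ⟨hK, hHK⟩⟩
  choose F hF using hex
  have hfin : (F '' 𝓒).Finite := Set.toFinite _
  have h1 := h.le_card_of_isCoatom hS hfin.toFinset
    (by
      intro K hK
      rw [Set.Finite.mem_toFinset] at hK
      obtain ⟨H, hH, rfl⟩ := hK
      exact (hF H (h𝓒.1 H hH)).1)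
    (by
      intro z
      have hz : z ∈ ⋃ H ∈ 𝓒, (H : Set (CyclicWreath S m)) := by rw [h𝓒.2]; trivial
      simp only [Set.mem_iUnion] at hz
      obtain ⟨H, hH, hzH⟩ := hz
      exact ⟨F H, by rw [Set.Finite.mem_toFinset]; exact ⟨H, hH, rfl⟩,
        (hF H (h𝓒.1 H hH)).2 hzH⟩)
  refine le_trans (Nat.cast_le.2 h1) ?_
  rw [← hfin.encard_eq_coe_toFinset_card]
  exact Set.encard_image_le _ _

theorem theorem1 {S : Type*} [Group S] [Finite S] [IsSimpleGroup S]
    (hS : ∃ a b : S, a * b ≠ b * a) (m : ℕ) (hm : 0 < m) :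
    (∀ (A : Set S) (𝓜 : Finset (Subgroup S)), AdmissiblePair m A 𝓜 →
      ((numPrimeDivisors m + ∑ M ∈ 𝓜, M.index ^ (m - 1) : ℕ) : ℕ∞) ≤
        coveringNumber (CyclicWreath S m)) ∧
    (∀ 𝓝 : Finset (Subgroup S), IsCovering (𝓝 : Set (Subgroup S)) →
      coveringNumber (CyclicWreath S m) ≤
        ((numPrimeDivisors m + ∑ M ∈ 𝓝, M.index ^ (m - 1) : ℕ) : ℕ∞)) := by
  have : NeZero m := ⟨hm.ne'⟩
  exact ⟨fun A 𝓜 h => h.le_coveringNumber hS, fun 𝓝 h => coveringNumber_cyclicWreath_le m 𝓝 h⟩
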